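/- Let $m,n\in\mathbb{N}_0$ with $m+n>1$, and let $\Theta=\{\theta_{ij}\in\mathbb{R}:1\le i<j\le m+n\}$. Let $B_\Theta^{m,n}$ be the universal unital $C^*$-algebra generated by $s_1,\dots,s_{m+n}$ subject to $s_is_j=e^{2\pi\mathrm{i}\theta_{ij}}s_js_i$ for $1\le i<j\le m+n$, $s_i^*s_i=1$ for $1\le i\le m+n$, and $s_is_i^*=1$ for $1\le i\le m$. Let $\mathcal{A}_\Theta^{m+n}$ be the noncommutative torus, that is, the universal unital $C^*$-algebra generated by unitaries $u_1,\dots,u_{m+n}$ subject to $u_iu_j=e^{2\pi\mathrm{i}\theta_{ij}}u_ju_i$ for $i<j$. Let $M_\Theta$ be the real skew-symmetric $(m+n)\times(m+n)$ matrix whose $(i,j)$ entry is $\theta_{ij}$ for $i<j$, and suppose that $\Theta$ is nondegenerate, i.e. $x=0$ is the only $x\in\mathbb{Z}^{m+n}$ with $e^{2\pi\mathrm{i}\langle x,M_\Theta y\rangle}=1$ for all $y\in\mathbb{Z}^{m+n}$. Let $J$ be the closed two-sided ideal of $B_\Theta^{m,n}$ generated by $1-s_{m+1}s_{m+1}^*,\dots,1-s_{m+n}s_{m+n}^*$.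 Then $J$ is the unique maximal closed ideal of $B_\Theta^{m,n}$: a closed two-sided ideal of $B_\Theta^{m,n}$ is maximal among the proper closed two-sided ideals if and only if it equals $J$. Moreover, there is a surjective unital $*$-homomorphism $\mu:B_\Theta^{m,n}\to\mathcal{A}_\Theta^{m+n}$ with $\mu(s_i)=u_i$ for all $i$ and $\ker\mu=J$, and it induces an isometric $*$-isomorphism $B_\Theta^{m,n}/J\cong\mathcal{A}_\Theta^{m+n}$, i.e. $\|\mu(x)\|=\operatorname{dist}(x,J)$ for all $x$. The $C^*$-algebra $\mathcal{A}_\Theta^{m+n}$ is simple: it is nonzero and has no closed two-sided ideals other than $0$ and itself. -/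

import Mathlib

noncomputable section

/-! ### The free unital `*`-algebra on a set of generators -/

/-- The free unital complex `*`-algebra on `ι`: noncommutative polynomials in the letters
`(i, false)` (the generator `x i`) and `(i, true)` (its adjoint `(x i)*`). -/
def FreeStarAlgebra (ι : Type*) : Type _ := MonoidAlgebra ℂ (FreeMonoid (ι × Bool))

namespace FreeStarAlgebra

variable {ι : Type*}

instance : Ring (FreeStarAlgebra ι) :=
  inferInstanceAs (Ring (MonoidAlgebra ℂ (FreeMonoid (ι × Bool))))

instance : Algebra ℂ (FreeStarAlgebra ι) :=
  inferInstanceAs (Algebra ℂ (MonoidAlgebra ℂ (FreeMonoid (ι × Bool))))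

/-- The element `c • w` for a scalar `c` and a word `w`. -/
def mono (w : FreeMonoid (ι × Bool)) (c : ℂ) : FreeStarAlgebra ι :=
  MonoidAlgebra.single w c

/-- The generator `x i`. -/
def gen (i : ι) : FreeStarAlgebra ι := mono (FreeMonoid.of (i, false)) 1

/-- The involution as a ring homomorphism into the opposite ring: it conjugates scalars, reverses
words and exchanges each letter with its adjoint. -/
def starHom : FreeStarAlgebra ι →+* (FreeStarAlgebra ι)ᵐᵒᵖ :=
  MonoidAlgebra.liftNCRingHom
    ((algebraMap ℂ (FreeStarAlgebra ι)ᵐᵒᵖ).comp (starRingEnd ℂ))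
    (FreeMonoid.lift fun a => MulOpposite.op (mono (FreeMonoid.of (a.1, !a.2)) 1))
    (fun c _ => Algebra.commutes (starRingEnd ℂ c) _)

instance : Star (FreeStarAlgebra ι) := ⟨fun x => (starHom x).unop⟩

theorem star_def' (x : FreeStarAlgebra ι) : star x = (starHom x).unop := rfl

theorem starHom_mono (w : FreeMonoid (ι × Bool)) (c : ℂ) :
    starHom (mono w c) = algebraMap ℂ (FreeStarAlgebra ι)ᵐᵒᵖ (starRingEnd ℂ c) *
      FreeMonoid.lift (fun a : ι × Bool =>
        MulOpposite.op (mono (FreeMonoid.of (a.1, !a.2)) 1)) w :=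
  MonoidAlgebra.liftNCRingHom_single _ _ _ _ _

theorem mono_mul (v w : FreeMonoid (ι × Bool)) (c d : ℂ) :
    mono v c * mono w d = mono (v * w) (c * d) :=
  MonoidAlgebra.single_mul_single _ _ _ _

theorem one_def' : (1 : FreeStarAlgebra ι) = mono 1 1 := rfl

theorem smul_mono (w : FreeMonoid (ι × Bool)) (c d : ℂ) :
    c • mono w d = mono w (c * d) :=
  MonoidAlgebra.smul_single _ _ _

theorem star_add' (x y : FreeStarAlgebra ι) : star (x + y) = star x + star y := by
  simp only [star_def', map_add, MulOpposite.unop_add]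

theorem star_mul' (x y : FreeStarAlgebra ι) : star (x * y) = star y * star x := by
  simp only [star_def', map_mul, MulOpposite.unop_mul]

theorem star_letter (a : ι × Bool) (c : ℂ) :
    star (mono (FreeMonoid.of a) c) = mono (FreeMonoid.of (a.1, !a.2)) (starRingEnd ℂ c) := by
  rw [star_def', starHom_mono, FreeMonoid.lift_eval_of, ← Algebra.smul_def, MulOpposite.unop_smul,
    MulOpposite.unop_op, smul_mono, mul_one]

theorem star_scalar (c : ℂ) :
    star (mono (1 : FreeMonoid (ι × Bool)) c) = mono 1 (starRingEnd ℂ c) := by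
  rw [star_def', starHom_mono, map_one, ← Algebra.smul_def, MulOpposite.unop_smul,
    MulOpposite.unop_one, one_def', smul_mono, mul_one]

/-- Every statement that is additive, multiplicative and true on scalars and letters holds. -/
theorem induct {motive : FreeStarAlgebra ι → Prop} (x : FreeStarAlgebra ι)
    (scalar : ∀ c, motive (mono 1 c)) (letter : ∀ a, motive (mono (FreeMonoid.of a) 1))
    (add : ∀ x y, motive x → motive y → motive (x + y))
    (mul : ∀ x y, motive x → motive y → motive (x * y)) : motive x := by
  have hw : ∀ w : FreeMonoid (ι × Bool), motive (mono w 1) := by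
    intro w
    induction w using FreeMonoid.inductionOn with
    | one => exact scalar 1
    | of a => exact letter a
    | mul v w hv hw =>
      have h := mul _ _ hv hw
      rwa [mono_mul, one_mul] at h
  refine MonoidAlgebra.induction_linear (motive := motive) x ?_ add ?_
  · have h := scalar 0
    rwa [show mono (1 : FreeMonoid (ι × Bool)) 0 = 0 from MonoidAlgebra.single_zero _] at h
  · intro w c
    have h := mul _ _ (scalar c) (hw w)
    rwa [mono_mul, one_mul, mul_one] at h

instance : StarRing (FreeStarAlgebra ι) where
  star_involutive x := by
    induction x using induct with
    | scalar c => rw [star_scalar, star_scalar, Complex.conj_conj]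
    | letter a => rw [star_letter, star_letter, Complex.conj_conj, Bool.not_not]
    | add x y hx hy => rw [star_add', star_add', hx, hy]
    | mul x y hx hy => rw [star_mul', star_mul', hx, hy]
  star_mul := star_mul'
  star_add := star_add'

instance : StarModule ℂ (FreeStarAlgebra ι) where
  star_smul c x := by
    have h : ∀ (d : ℂ) (y : FreeStarAlgebra ι), d • y = mono 1 d * y := by
      intro d y
      rw [Algebra.smul_def]
      rfl
    rw [h, star_mul', star_scalar, h]
    have h2 : mono (1 : FreeMonoid (ι × Bool)) (starRingEnd ℂ c) =
      algebraMap ℂ (FreeStarAlgebra ι) (starRingEnd ℂ c) := rfl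
    rw [Complex.star_def, h2, Algebra.commutes]

end FreeStarAlgebra

/-! ### Universal C*-algebras given by generators and relations -/

/-- A C*-seminorm: a submultiplicative seminorm satisfying the C*-identity. -/
structure IsCStarSeminorm {A : Type*} [Ring A] [StarRing A] [Algebra ℂ A]
    (p : Seminorm ℂ A) : Prop where
  mul_le : ∀ x y, p (x * y) ≤ p x * p y
  star_mul_self : ∀ x, p (star x * x) = p x * p x

/-- The C*-seminorms on the free `*`-algebra in which the relations `r = 0`, `r ∈ R`, hold. -/
def RelSeminorm {ι : Type*} (R : Set (FreeStarAlgebra ι)) : Type _ :=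
  {p : Seminorm ℂ (FreeStarAlgebra ι) // IsCStarSeminorm p ∧ ∀ r ∈ R, p r = 0}

/-- The relations bound every element uniformly; this is the condition for the universal
C*-algebra to exist. -/
def AdmissibleRel {ι : Type*} (R : Set (FreeStarAlgebra ι)) : Prop :=
  ∀ x, BddAbove (Set.range fun p : RelSeminorm R => p.1 x)

/-- The free `*`-algebra equipped with the largest C*-seminorm in which the relations `R` hold. -/
def PreUniversal {ι : Type*} (R : Set (FreeStarAlgebra ι)) (_hR : AdmissibleRel R) : Type _ :=
  FreeStarAlgebra ι

namespace PreUniversal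

variable {ι : Type*} {R : Set (FreeStarAlgebra ι)} {hR : AdmissibleRel R}

instance : Nonempty (RelSeminorm R) :=
  ⟨⟨0, ⟨fun _ _ => by simp, fun _ => by simp⟩, fun _ _ => rfl⟩⟩

instance : Ring (PreUniversal R hR) := inferInstanceAs (Ring (FreeStarAlgebra ι))
instance : Algebra ℂ (PreUniversal R hR) := inferInstanceAs (Algebra ℂ (FreeStarAlgebra ι))
instance : StarRing (PreUniversal R hR) := inferInstanceAs (StarRing (FreeStarAlgebra ι))
instance : StarModule ℂ (PreUniversal R hR) :=
  inferInstanceAs (StarModule ℂ (FreeStarAlgebra ι))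

/-- The value at `x` of a C*-seminorm in which the relations hold. -/
def val (p : RelSeminorm R) : Seminorm ℂ (PreUniversal R hR) := p.1

/-- The universal C*-seminorm. -/
instance : Norm (PreUniversal R hR) := ⟨fun x => ⨆ p : RelSeminorm R, val p x⟩

theorem norm_def (x : PreUniversal R hR) : ‖x‖ = ⨆ p : RelSeminorm R, val p x := rfl

theorem val_le_norm (p : RelSeminorm R) (x : PreUniversal R hR) : val p x ≤ ‖x‖ :=
  le_ciSup (hR x) p

theorem norm_le' {x : PreUniversal R hR} {c : ℝ} (h : ∀ p : RelSeminorm R, val p x ≤ c) :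
    ‖x‖ ≤ c := ciSup_le h

theorem norm_nonneg' (x : PreUniversal R hR) : 0 ≤ ‖x‖ :=
  Real.iSup_nonneg fun p => apply_nonneg (val p) x

theorem norm_mul_le' (x y : PreUniversal R hR) : ‖x * y‖ ≤ ‖x‖ * ‖y‖ :=
  norm_le' fun p => (p.2.1.mul_le x y).trans
    (mul_le_mul (val_le_norm p x) (val_le_norm p y) (apply_nonneg (val p) y) (norm_nonneg' x))

/-- The universal C*-seminorm as a seminorm. -/
def univSeminorm : Seminorm ℂ (PreUniversal R hR) :=
  Seminorm.of (fun x => ‖x‖)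
    (fun x y => norm_le' fun p => (map_add_le_add (val p) x y).trans
      (add_le_add (val_le_norm p x) (val_le_norm p y)))
    (fun c x => by
      simp only [norm_def, map_smul_eq_mul]
      rw [Real.mul_iSup_of_nonneg (norm_nonneg c)])

instance : SeminormedRing (PreUniversal R hR) :=
  { (inferInstance : Ring (PreUniversal R hR)),
    (univSeminorm (R := R) (hR := hR)).toAddGroupSeminorm.toSeminormedAddCommGroup with
    norm_mul_le := norm_mul_le' }

instance : NormedAlgebra ℂ (PreUniversal R hR) where
  norm_smul_le c x := (map_smul_eq_mul (univSeminorm (R := R) (hR := hR)) c x).le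

theorem norm_star_mul_self' (x : PreUniversal R hR) : ‖x‖ * ‖x‖ ≤ ‖star x * x‖ := by
  have h : ‖x‖ ≤ Real.sqrt ‖star x * x‖ := norm_le' fun p =>
    Real.le_sqrt_of_sq_le (by
      rw [sq]
      exact (p.2.1.star_mul_self x).symm.le.trans (val_le_norm p (star x * x)))
  calc ‖x‖ * ‖x‖ ≤ Real.sqrt ‖star x * x‖ * Real.sqrt ‖star x * x‖ :=
        mul_self_le_mul_self (norm_nonneg' x) h
    _ = ‖star x * x‖ := Real.mul_self_sqrt (norm_nonneg' _)

theorem norm_le_norm_star (x : PreUniversal R hR) : ‖x‖ ≤ ‖star x‖ := by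
  rcases (norm_nonneg' x).eq_or_lt with h | h
  · rw [← h]
    exact norm_nonneg' _
  · exact le_of_mul_le_mul_right ((norm_star_mul_self' x).trans (norm_mul_le' _ _)) h

instance : NormedStarGroup (PreUniversal R hR) where
  norm_star_le x := by
    have h := norm_le_norm_star (star x)
    rwa [star_star] at h

end PreUniversal

/-- The universal C*-algebra with generators indexed by `ι` and relations `r = 0`, `r ∈ R`: the
Hausdorff completion of the free `*`-algebra in the largest C*-seminorm in which the relations
hold. -/
def UniversalCStar {ι : Type*} (R : Set (FreeStarAlgebra ι)) (hR : AdmissibleRel R) : Type _ :=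
  UniformSpace.Completion (PreUniversal R hR)

namespace UniversalCStar

open UniformSpace

variable {ι : Type*} {R : Set (FreeStarAlgebra ι)} {hR : AdmissibleRel R}

instance : NormedRing (UniversalCStar R hR) :=
  inferInstanceAs (NormedRing (Completion (PreUniversal R hR)))

instance : CompleteSpace (UniversalCStar R hR) :=
  inferInstanceAs (CompleteSpace (Completion (PreUniversal R hR)))

instance : Algebra ℂ (UniversalCStar R hR) :=
  inferInstanceAs (Algebra ℂ (Completion (PreUniversal R hR)))

instance : NormedAlgebra ℂ (UniversalCStar R hR) where
  norm_smul_le c x :=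
    norm_smul_le (α := ℂ) (β := Completion (PreUniversal R hR)) c x

instance : Star (UniversalCStar R hR) :=
  ⟨Completion.map (star : PreUniversal R hR → PreUniversal R hR)⟩

/-- The image in the completion of an element of the free `*`-algebra. -/
def incl (x : PreUniversal R hR) : UniversalCStar R hR := (x : Completion (PreUniversal R hR))

theorem star_incl (x : PreUniversal R hR) :
    star (incl x : UniversalCStar R hR) = incl (star x) :=
  Completion.map_coe (star_isometry (E := PreUniversal R hR)).uniformContinuous x

theorem incl_add (x y : PreUniversal R hR) :
    (incl (x + y) : UniversalCStar R hR) = incl x + incl y := Completion.coe_add x y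

theorem incl_mul (x y : PreUniversal R hR) :
    (incl (x * y) : UniversalCStar R hR) = incl x * incl y := Completion.coe_mul x y

theorem incl_smul (c : ℂ) (x : PreUniversal R hR) :
    (incl (c • x) : UniversalCStar R hR) = c • incl x := Completion.coe_smul c x

theorem norm_incl (x : PreUniversal R hR) : ‖(incl x : UniversalCStar R hR)‖ = ‖x‖ :=
  Completion.norm_coe x

theorem continuous_star' : Continuous (star : UniversalCStar R hR → UniversalCStar R hR) :=
  Completion.continuous_map

/-- A closed condition that holds on the free `*`-algebra holds everywhere. -/
theorem induct {motive : UniversalCStar R hR → Prop} (x : UniversalCStar R hR)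
    (closed : IsClosed {x | motive x}) (incl : ∀ x, motive (incl x)) : motive x :=
  Completion.induction_on (α := PreUniversal R hR) (p := motive) x closed incl

theorem star_add' (x y : UniversalCStar R hR) : star (x + y) = star x + star y := by
  have hs := continuous_star' (R := R) (hR := hR)
  induction x using induct with
  | closed =>
    exact isClosed_eq (hs.comp (continuous_id.add continuous_const)) (hs.add continuous_const)
  | incl x =>
    induction y using induct with
    | closed =>
      exact isClosed_eq (hs.comp (continuous_const.add continuous_id)) (continuous_const.add hs)
    | incl y => rw [← incl_add, star_incl, star_incl, star_incl, star_add, incl_add]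

theorem star_mul' (x y : UniversalCStar R hR) : star (x * y) = star y * star x := by
  have hs := continuous_star' (R := R) (hR := hR)
  induction x using induct with
  | closed =>
    exact isClosed_eq (hs.comp (continuous_id.mul continuous_const)) (continuous_const.mul hs)
  | incl x =>
    induction y using induct with
    | closed =>
      exact isClosed_eq (hs.comp (continuous_const.mul continuous_id)) (hs.mul continuous_const)
    | incl y => rw [← incl_mul, star_incl, star_incl, star_incl, star_mul, incl_mul]

instance : StarRing (UniversalCStar R hR) where
  star_involutive x := by
    have hs := continuous_star' (R := R) (hR := hR)
    induction x using induct with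
    | closed => exact isClosed_eq (hs.comp hs) continuous_id
    | incl x => rw [star_incl, star_incl, star_star]
  star_mul := star_mul'
  star_add := star_add'

instance : StarModule ℂ (UniversalCStar R hR) where
  star_smul c x := by
    have hs := continuous_star' (R := R) (hR := hR)
    induction x using induct with
    | closed =>
      exact isClosed_eq (hs.comp (continuous_const_smul c)) (hs.const_smul (star c))
    | incl x => rw [← incl_smul, star_incl, star_incl, star_smul, incl_smul]

instance : CStarRing (UniversalCStar R hR) where
  norm_mul_self_le x := by
    have hs := continuous_star' (R := R) (hR := hR)
    induction x using induct with
    | closed =>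
      exact isClosed_le (continuous_norm.mul continuous_norm)
        (continuous_norm.comp (hs.mul continuous_id))
    | incl x =>
      rw [star_incl, ← incl_mul, norm_incl, norm_incl]
      exact PreUniversal.norm_star_mul_self' x

instance : CStarAlgebra (UniversalCStar R hR) where

/-- The canonical `*`-homomorphism of the free `*`-algebra into the universal C*-algebra. -/
def of (R : Set (FreeStarAlgebra ι)) (hR : AdmissibleRel R) :
    FreeStarAlgebra ι →⋆ₐ[ℂ] UniversalCStar R hR where
  toFun x := incl x
  map_one' := rfl
  map_mul' := incl_mul
  map_zero' := rfl
  map_add' := incl_add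
  commutes' _ := rfl
  map_star' x := (star_incl x).symm

end UniversalCStar

/-! ### Free twists of unitaries and isometries, noncommutative tori -/

open FreeStarAlgebra in
/-- The relations `xᵢ xⱼ = e^{2πiθᵢⱼ} xⱼ xᵢ` for `i < j`, `xᵢ* xᵢ = 1` for all `i`, and
`xᵢ xᵢ* = 1` for the first `m` of the `N` generators. Only the entries `θᵢⱼ`, `i < j`, of `Θ`
are used. -/
inductive TwistRel (N m : ℕ) (Θ : Fin N → Fin N → ℝ) : FreeStarAlgebra (Fin N) → Prop
  | twist (i j : Fin N) (hij : i < j) : TwistRel N m Θ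
      (gen i * gen j - Complex.exp (2 * Real.pi * Complex.I * Θ i j) • (gen j * gen i))
  | isometry (i : Fin N) : TwistRel N m Θ (star (gen i) * gen i - 1)
  | unitary (i : Fin N) (hi : i.val < m) : TwistRel N m Θ (gen i * star (gen i) - 1)

theorem IsCStarSeminorm.le_star {A : Type*} [Ring A] [StarRing A] [Algebra ℂ A]
    {p : Seminorm ℂ A} (hp : IsCStarSeminorm p) (x : A) : p x ≤ p (star x) := by
  rcases (apply_nonneg p x).eq_or_lt with h | h
  · rw [← h]
    exact apply_nonneg p _
  · exact le_of_mul_le_mul_right ((hp.star_mul_self x).symm.le.trans (hp.mul_le _ _)) h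

theorem IsCStarSeminorm.map_one_le {A : Type*} [Ring A] [StarRing A] [Algebra ℂ A]
    {p : Seminorm ℂ A} (hp : IsCStarSeminorm p) : p 1 ≤ 1 := by
  have h := hp.star_mul_self 1
  rw [star_one, mul_one] at h
  nlinarith [sq_nonneg (p 1 - 1), apply_nonneg p 1]

theorem admissible_twistRel (N m : ℕ) (Θ : Fin N → Fin N → ℝ) :
    AdmissibleRel {r | TwistRel N m Θ r} := by
  intro x
  suffices h : ∃ c : ℝ, 0 ≤ c ∧ ∀ p : RelSeminorm {r | TwistRel N m Θ r}, p.1 x ≤ c by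
    obtain ⟨c, -, hc⟩ := h
    exact ⟨c, by rintro _ ⟨p, rfl⟩; exact hc p⟩
  induction x using FreeStarAlgebra.induct with
  | scalar c =>
    refine ⟨‖c‖, norm_nonneg c, fun p => ?_⟩
    have h : FreeStarAlgebra.mono (1 : FreeMonoid (Fin N × Bool)) c = c • 1 := by
      rw [FreeStarAlgebra.one_def', FreeStarAlgebra.smul_mono, mul_one]
    rw [h, map_smul_eq_mul]
    exact mul_le_of_le_one_right (norm_nonneg c) p.2.1.map_one_le
  | letter a =>
    refine ⟨1, zero_le_one, fun p => ?_⟩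
    have hg : ∀ i, p.1 (FreeStarAlgebra.gen i) ≤ 1 := by
      intro i
      have h1 := p.2.1.star_mul_self (FreeStarAlgebra.gen i)
      have h2 := p.2.2 _ (TwistRel.isometry (m := m) (Θ := Θ) i)
      have h3 := map_add_le_add p.1 (star (FreeStarAlgebra.gen i) * FreeStarAlgebra.gen i - 1) 1
      rw [sub_add_cancel, h1, h2] at h3
      have h4 := p.2.1.map_one_le
      nlinarith [apply_nonneg p.1 (FreeStarAlgebra.gen i)]
    rcases a with ⟨i, b⟩
    cases b with
    | false => exact hg i
    | true =>
      refine (p.2.1.le_star _).trans ?_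
      rw [FreeStarAlgebra.star_letter, map_one]
      exact hg i
  | add x y hx hy =>
    obtain ⟨c, hc0, hc⟩ := hx
    obtain ⟨d, hd0, hd⟩ := hy
    exact ⟨c + d, add_nonneg hc0 hd0,
      fun p => (map_add_le_add p.1 x y).trans (add_le_add (hc p) (hd p))⟩
  | mul x y hx hy =>
    obtain ⟨c, hc0, hc⟩ := hx
    obtain ⟨d, hd0, hd⟩ := hy
    exact ⟨c * d, mul_nonneg hc0 hd0, fun p => (p.2.1.mul_le x y).trans
      (mul_le_mul (hc p) (hd p) (apply_nonneg p.1 y) hc0)⟩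

/-- The universal C*-algebra generated by `N` isometries with twist `Θ`, the first `m` of which
are unitary. -/
abbrev TwistAlgebra (N m : ℕ) (Θ : Fin N → Fin N → ℝ) : Type :=
  UniversalCStar {r | TwistRel N m Θ r} (admissible_twistRel N m Θ)

/-- The standard generators of `TwistAlgebra N m Θ`. -/
def TwistAlgebra.gen (N m : ℕ) (Θ : Fin N → Fin N → ℝ) (i : Fin N) : TwistAlgebra N m Θ :=
  UniversalCStar.of _ _ (FreeStarAlgebra.gen i)

/-- The free twist `B_Θ^{m,n}` of `m` unitaries and `n` isometries. -/
abbrev FreeTwist (m n : ℕ) (Θ : Fin (m + n) → Fin (m + n) → ℝ) : Type :=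
  TwistAlgebra (m + n) m Θ

/-- The standard generators of `B_Θ^{m,n}`; the indices `Fin.natAdd m i` with `i : Fin n` are those
of the `n` isometries. -/
def FreeTwist.gen (m n : ℕ) (Θ : Fin (m + n) → Fin (m + n) → ℝ) (i : Fin (m + n)) :
    FreeTwist m n Θ :=
  TwistAlgebra.gen (m + n) m Θ i

/-- The noncommutative torus `A_Θ^N`: all `N` generators are unitary. -/
abbrev NCTorus (N : ℕ) (Θ : Fin N → Fin N → ℝ) : Type := TwistAlgebra N N Θ

/-- The standard generators of the noncommutative torus. -/
def NCTorus.gen (N : ℕ) (Θ : Fin N → Fin N → ℝ) (i : Fin N) : NCTorus N Θ :=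
  TwistAlgebra.gen N N Θ i

/-- The skew-symmetric matrix whose entry at `(i, j)` is `θᵢⱼ` for `i < j`. -/
def skewMatrix {N : ℕ} (Θ : Fin N → Fin N → ℝ) : Matrix (Fin N) (Fin N) ℝ :=
  Matrix.of fun i j => if i < j then Θ i j else if j < i then -Θ j i else 0

/-- A real matrix `M` is nondegenerate if `x = 0` is the only `x ∈ ℤ^N` with
`e^{2πi⟨x, M y⟩} = 1` for all `y ∈ ℤ^N`. -/
def IsNondegenerate {N : ℕ} (M : Matrix (Fin N) (Fin N) ℝ) : Prop :=
  ∀ x : Fin N → ℤ,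
    (∀ y : Fin N → ℤ, Complex.exp (2 * Real.pi * Complex.I *
      (((fun i => (x i : ℝ)) ⬝ᵥ M.mulVec (fun i => (y i : ℝ)) : ℝ) : ℂ)) = 1) → x = 0

/-! ### Closed ideals -/

/-- The closed two-sided ideal generated by a set. -/
def closedIdealSpan {A : Type*} [CStarAlgebra A] (S : Set A) : TwoSidedIdeal A :=
  sInf {I : TwoSidedIdeal A | IsClosed (I : Set A) ∧ S ⊆ (I : Set A)}

/-- Maximal elements among the proper closed two-sided ideals. -/
def IsMaximalClosedIdeal {A : Type*} [CStarAlgebra A] (I : TwoSidedIdeal A) : Prop :=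
  Maximal (fun K : TwoSidedIdeal A => IsClosed (K : Set A) ∧ K ≠ ⊤) I

/-- A nonzero C*-algebra is simple if it has no closed two-sided ideals besides `0` and itself. -/
def IsSimpleCStar (A : Type*) [CStarAlgebra A] : Prop :=
  Nontrivial A ∧ ∀ I : TwoSidedIdeal A, IsClosed (I : Set A) → I = ⊥ ∨ I = ⊤

/-- The ideal `J` of `B_Θ^{m,n}` generated by the defect projections `1 - sₘ₊ᵢ sₘ₊ᵢ*`. -/
def defectIdeal (m n : ℕ) (Θ : Fin (m + n) → Fin (m + n) → ℝ) :
    TwoSidedIdeal (FreeTwist m n Θ) :=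
  closedIdealSpan (Set.range fun i : Fin n =>
    1 - FreeTwist.gen m n Θ (Fin.natAdd m i) * star (FreeTwist.gen m n Θ (Fin.natAdd m i)))

end

/-! ### Closed two-sided ideals of C*-algebras -/

/-! Write `B` for the free twist and `J` for its defect ideal. The key point is that every proper
closed ideal `I` of `B` lies in `J`, and this is proved without analysing the structure of `J`. Call
`b` asymptotic if `b * w` comes arbitrarily close to `I` for suitable monomials `w` in the
generators. Monomials commute up to phases and are contractions, so lengthening `w` on either side
does no harm; hence the asymptotic elements form a closed two-sided ideal. It contains `I`. It
contains every defect `1 - sᵢsᵢ*`, since `(1 - sᵢsᵢ*)sᵢ = 0`. It is proper, since `w*w = 1` bounds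
the distance from `w` to `I` below by that from `1`. So it is a proper closed ideal containing both
`I` and `J`. Simplicity of the torus makes `J` maximal, so this ideal is `J`
(`FreeTwist.le_defectIdeal`).

That the torus is `B/J` isometrically (`FreeTwist.exists_quotientMap`) follows from the definition
of the universal norm as a supremum of C*-seminorms. The distance to a closed ideal is a C*-seminorm
(`TwoSidedIdeal.infDist_star_mul_self`), and the torus relations hold modulo `J`, so the distance to
`J` is at most the torus norm.

Simplicity of the torus (`NCTorus.isSimpleCStar`) comes from averaging. Products of the generators
form a projective representation `U` of `ℤ^N` with dense span, and conjugation by `U b` multiplies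
`U a` by a character of `b`, nontrivial for `a ≠ 0` by nondegeneracy. Averages over growing boxes
therefore send every element close to scalars. No faithful trace is needed: orbits under these
conjugations are totally bounded, so finitely many conjugates of an average of a positive `x`
control `x` itself (`isSimpleCStar_of_average`). The torus is nonzero because weighted shifts on
`ℓ²(ℤ^N)` satisfy its relations. -/

namespace TwoSidedIdeal

variable {A : Type*} [CStarAlgebra A]

/-- If `j* j` lies in a two-sided ideal, then `j` can be cut down to arbitrarily small norm by a
self-adjoint contraction which is `1` modulo the ideal. -/
theorem exists_norm_mul_lt (I : TwoSidedIdeal A) {j : A} (hj : star j * j ∈ I) {ε : ℝ}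
    (hε : 0 < ε) : ∃ d : A, 1 - d ∈ I ∧ star d = d ∧ ‖d‖ ≤ 1 ∧ ‖j * d‖ < ε := by
  let := CStarAlgebra.spectralOrder A
  have := CStarAlgebra.spectralOrderedRing A
  set a := star j * j with ha
  have ha0 : 0 ≤ a := star_mul_self_nonneg j
  have hsa : IsSelfAdjoint a := .star_mul_self j
  have hσ : ∀ t ∈ spectrum ℝ a, 0 ≤ t := fun t ht => spectrum_nonneg_of_nonneg ha0 ht
  -- The cutoff is `d = δ(a + δ)⁻¹`, for which `1 - d = a(a + δ)⁻¹`. On the spectrum `d a d` is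
  -- `δ²t/(t + δ)² ≤ δ/4`, so `δ = ε²` yields `‖j * d‖ ≤ ε/2`.
  set δ : ℝ := ε ^ 2 with hδ
  have hδ0 : 0 < δ := by positivity
  have hne : ∀ t ∈ spectrum ℝ a, t + δ ≠ 0 := fun t ht => by have := hσ t ht; positivity
  have hc : ContinuousOn (fun t : ℝ => (t + δ)⁻¹) (spectrum ℝ a) :=
    (continuousOn_id.add continuousOn_const).inv₀ hne
  have hi : ContinuousOn (fun t : ℝ => t) (spectrum ℝ a) := continuousOn_id
  have hc' : ContinuousOn (fun t : ℝ => δ * (t + δ)⁻¹) (spectrum ℝ a) := continuousOn_const.mul hc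
  set d := cfc (fun t : ℝ => δ * (t + δ)⁻¹) a with hd
  have hdsa : star d = d := (cfc_predicate (R := ℝ) _ a : IsSelfAdjoint d)
  refine ⟨d, ?_, hdsa, ?_, ?_⟩
  · have h1 : 1 - d = a * cfc (fun t : ℝ => (t + δ)⁻¹) a := by
      have : a * cfc (fun t : ℝ => (t + δ)⁻¹) a
          = cfc (fun t : ℝ => t) a * cfc (fun t : ℝ => (t + δ)⁻¹) a := by rw [cfc_id' ℝ a]
      rw [this, ← cfc_mul _ _ a hi hc, ← cfc_const_one ℝ a, hd,
        ← cfc_sub _ _ a continuousOn_const hc']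
      refine cfc_congr fun t ht => ?_
      have := hne t ht
      field_simp
      ring
    rw [h1]
    exact I.mul_mem_right _ _ hj
  · refine norm_cfc_le zero_le_one fun t ht => ?_
    have := hσ t ht
    rw [Real.norm_of_nonneg (by positivity), ← div_eq_mul_inv, div_le_one (by positivity)]
    linarith
  · have h2 : ‖j * d‖ * ‖j * d‖ ≤ δ / 4 := by
      rw [← CStarRing.norm_star_mul_self, star_mul, hdsa,
        show d * star j * (j * d) = d * (a * d) by rw [ha]; simp only [mul_assoc]]
      have : d * (a * d)
          = cfc (fun t : ℝ => δ * (t + δ)⁻¹ * (t * (δ * (t + δ)⁻¹))) a := by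
        have hm : ContinuousOn (fun t : ℝ => t * (δ * (t + δ)⁻¹)) (spectrum ℝ a) := hi.mul hc'
        rw [cfc_mul _ _ a hc' hm, cfc_mul _ _ a hi hc',
          cfc_id' ℝ a]
      rw [this]
      refine norm_cfc_le (by positivity) fun t ht => ?_
      have := hσ t ht
      have h3 := hne t ht
      rw [Real.norm_of_nonneg (by positivity)]
      have h4 : δ * (t + δ)⁻¹ * (t * (δ * (t + δ)⁻¹)) = δ * ((δ * t) / (t + δ) ^ 2) := by
        field_simp
      have h5 : (δ * t) / (t + δ) ^ 2 ≤ 1 / 4 := by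
        rw [div_le_div_iff₀ (by positivity) (by norm_num)]
        nlinarith [sq_nonneg (t - δ)]
      rw [h4]
      nlinarith
    nlinarith [norm_nonneg (j * d)]

variable {I : TwoSidedIdeal A}

theorem smul_mem_of_mem (c : ℂ) {x : A} (hx : x ∈ I) : c • x ∈ I := by
  rw [← one_mul x, ← smul_mul_assoc]
  exact I.mul_mem_left _ _ hx

theorem coe_nonempty (I : TwoSidedIdeal A) : (I : Set A).Nonempty := ⟨0, I.zero_mem⟩

theorem mem_of_infDist_eq_zero (hI : IsClosed (I : Set A)) {x : A}
    (hx : Metric.infDist x (I : Set A) = 0) : x ∈ I :=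
  (hI.mem_iff_infDist_zero I.coe_nonempty).2 hx

theorem infDist_eq_zero_of_mem {x : A} (hx : x ∈ I) : Metric.infDist x (I : Set A) = 0 :=
  Metric.infDist_zero_of_mem hx

theorem infDist_le_norm_sub {x j : A} (hj : j ∈ I) : Metric.infDist x (I : Set A) ≤ ‖x - j‖ := by
  rw [← dist_eq_norm]
  exact Metric.infDist_le_dist_of_mem hj

theorem infDist_le_norm (x : A) : Metric.infDist x (I : Set A) ≤ ‖x‖ := by
  simpa using infDist_le_norm_sub (x := x) I.zero_mem

theorem exists_norm_sub_lt (I : TwoSidedIdeal A) (x : A) {ε : ℝ} (hε : 0 < ε) :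
    ∃ j ∈ I, ‖x - j‖ < Metric.infDist x (I : Set A) + ε := by
  obtain ⟨j, hj, h⟩ := (Metric.infDist_lt_iff I.coe_nonempty).1
    (lt_add_of_pos_right (Metric.infDist x (I : Set A)) hε)
  exact ⟨j, hj, by rwa [dist_eq_norm] at h⟩

theorem infDist_add_le (x y : A) :
    Metric.infDist (x + y) (I : Set A) ≤ Metric.infDist x I + Metric.infDist y I := by
  refine le_of_forall_pos_le_add fun ε hε => ?_
  obtain ⟨j, hj, h1⟩ := I.exists_norm_sub_lt x (half_pos hε)
  obtain ⟨k, hk, h2⟩ := I.exists_norm_sub_lt y (half_pos hε)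
  have h3 := infDist_le_norm_sub (x := x + y) (I.add_mem hj hk)
  have h4 : ‖x + y - (j + k)‖ ≤ ‖x - j‖ + ‖y - k‖ := by
    rw [add_sub_add_comm]; exact norm_add_le _ _
  linarith

theorem infDist_smul_le (c : ℂ) (x : A) :
    Metric.infDist (c • x) (I : Set A) ≤ ‖c‖ * Metric.infDist x I := by
  rcases eq_or_ne c 0 with rfl | hc
  · rw [zero_smul, infDist_eq_zero_of_mem I.zero_mem]; simp
  have hc' : 0 < ‖c‖ := norm_pos_iff.2 hc
  refine le_of_forall_pos_le_add fun ε hε => ?_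
  obtain ⟨j, hj, h1⟩ := I.exists_norm_sub_lt x (div_pos hε hc')
  have h3 := infDist_le_norm_sub (x := c • x) (smul_mem_of_mem c hj)
  rw [← smul_sub, norm_smul] at h3
  have h4 := mul_lt_mul_of_pos_left h1 hc'
  rw [mul_add, mul_div_cancel₀ _ hc'.ne'] at h4
  linarith

theorem infDist_mul_le_left (x y : A) :
    Metric.infDist (x * y) (I : Set A) ≤ ‖x‖ * Metric.infDist y I := by
  refine le_of_forall_pos_le_add fun ε hε => ?_
  have hx : 0 < ‖x‖ + 1 := by positivity
  obtain ⟨j, hj, h1⟩ := I.exists_norm_sub_lt y (div_pos hε hx)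
  have h3 := infDist_le_norm_sub (x := x * y) (I.mul_mem_left x j hj)
  rw [← mul_sub] at h3
  have h4 := norm_mul_le x (y - j)
  have h5 := mul_le_mul_of_nonneg_left h1.le (norm_nonneg x)
  have h6 : ‖x‖ * (ε / (‖x‖ + 1)) ≤ ε := by
    rw [mul_div_assoc', div_le_iff₀ hx]
    nlinarith
  rw [mul_add] at h5
  linarith

theorem infDist_mul_le_right (x y : A) :
    Metric.infDist (x * y) (I : Set A) ≤ Metric.infDist x I * ‖y‖ := by
  refine le_of_forall_pos_le_add fun ε hε => ?_
  have hy : 0 < ‖y‖ + 1 := by positivity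
  obtain ⟨j, hj, h1⟩ := I.exists_norm_sub_lt x (div_pos hε hy)
  have h3 := infDist_le_norm_sub (x := x * y) (I.mul_mem_right j y hj)
  rw [← sub_mul] at h3
  have h4 := norm_mul_le (x - j) y
  have h5 := mul_le_mul_of_nonneg_right h1.le (norm_nonneg y)
  have h6 : ε / (‖y‖ + 1) * ‖y‖ ≤ ε := by
    rw [div_mul_eq_mul_div, div_le_iff₀ hy]
    nlinarith
  rw [add_mul] at h5
  linarith

theorem infDist_sub_mem {x j : A} (hj : j ∈ I) :
    Metric.infDist (x - j) (I : Set A) = Metric.infDist x I := by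
  refine le_antisymm ?_ ?_
  · have h := infDist_add_le (I := I) x (-j)
    rwa [infDist_eq_zero_of_mem (I.neg_mem hj), add_zero, ← sub_eq_add_neg] at h
  · have h := infDist_add_le (I := I) (x - j) j
    rwa [infDist_eq_zero_of_mem hj, add_zero, sub_add_cancel] at h

/-- Only `x` has to be approximated: replacing it by `x - j` with `j ∈ I` changes the product by `j
* y ∈ I`, and then the one-sided bound applies. -/
theorem infDist_mul_le (x y : A) :
    Metric.infDist (x * y) (I : Set A) ≤ Metric.infDist x I * Metric.infDist y I := by
  refine le_of_forall_pos_le_add fun ε hε => ?_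
  have hy : 0 < Metric.infDist y (I : Set A) + 1 := by
    have := Metric.infDist_nonneg (x := y) (s := (I : Set A)); positivity
  obtain ⟨j, hj, h1⟩ := I.exists_norm_sub_lt x (div_pos hε hy)
  have h2 := infDist_mul_le_left (I := I) (x - j) y
  rw [sub_mul, infDist_sub_mem (I.mul_mem_right j y hj)] at h2
  have h5 := mul_le_mul_of_nonneg_right h1.le (Metric.infDist_nonneg (x := y) (s := (I : Set A)))
  have h6 : ε / (Metric.infDist y (I : Set A) + 1) * Metric.infDist y (I : Set A) ≤ ε := by
    rw [div_mul_eq_mul_div, div_le_iff₀ hy]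
    nlinarith
  rw [add_mul] at h5
  linarith

/-- A closed two-sided ideal of a C*-algebra is self-adjoint. -/
theorem star_mem_of_isClosed (hI : IsClosed (I : Set A)) {x : A} (hx : x ∈ I) : star x ∈ I := by
  refine mem_of_infDist_eq_zero hI (le_antisymm ?_ Metric.infDist_nonneg)
  refine le_of_forall_pos_le_add fun ε hε => ?_
  -- For `j = star x` the element `star j * j` is `x * star x`, which lies in `I`. Modulo `I`, `star
  -- x` agrees with the small element `star x * d`.
  obtain ⟨d, hd, -, -, h⟩ := I.exists_norm_mul_lt (j := star x)
    (by rw [star_star]; exact I.mul_mem_right _ _ hx) hε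
  have h1 := infDist_le_norm_sub (x := star x) (I.mul_mem_left (star x) _ hd)
  rw [mul_sub, mul_one, sub_sub_cancel] at h1
  linarith

theorem infDist_star (hI : IsClosed (I : Set A)) (x : A) :
    Metric.infDist (star x) (I : Set A) = Metric.infDist x I := by
  have key : ∀ y : A, Metric.infDist (star y) (I : Set A) ≤ Metric.infDist y I := fun y => by
    refine le_of_forall_pos_le_add fun ε hε => ?_
    obtain ⟨j, hj, h1⟩ := I.exists_norm_sub_lt y hε
    have h2 := infDist_le_norm_sub (x := star y) (star_mem_of_isClosed hI hj)
    rw [← star_sub, norm_star] at h2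
    linarith
  refine le_antisymm (key x) ?_
  simpa using key (star x)

/-- The quotient norm of a closed two-sided ideal satisfies the C*-identity. -/
theorem infDist_star_mul_self (hI : IsClosed (I : Set A)) (x : A) :
    Metric.infDist (star x * x) (I : Set A) = Metric.infDist x I * Metric.infDist x I := by
  refine le_antisymm ?_ ?_
  · exact (infDist_mul_le _ _).trans_eq (by rw [infDist_star hI])
  refine le_of_forall_pos_le_add fun ε hε => ?_
  obtain ⟨j, hj, h1⟩ := I.exists_norm_sub_lt (star x * x) (half_pos hε)
  -- The cutoff `d` nearly annihilates the approximant `j` of `star x * x`, while `x * d` equals `x`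
  -- modulo `I`. Hence the C*-identity in `A`, applied to `x * d`, gives the estimate.
  obtain ⟨d, hd, hds, hdn, h2⟩ := I.exists_norm_mul_lt (I.mul_mem_left (star j) _ hj) (half_pos hε)
  have h3 := infDist_le_norm_sub (x := x) (I.mul_mem_left x _ hd)
  rw [mul_sub, mul_one, sub_sub_cancel] at h3
  have h4 : ‖x * d‖ * ‖x * d‖ ≤ ‖star x * x - j‖ + ‖j * d‖ := by
    have h5 : star (x * d) * (x * d) = d * ((star x * x - j) * d) + d * (j * d) := by
      rw [star_mul, hds]; noncomm_ring
    rw [← CStarRing.norm_star_mul_self, h5]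
    refine (norm_add_le _ _).trans (add_le_add ?_ ?_)
    · calc _ ≤ ‖d‖ * (‖star x * x - j‖ * ‖d‖) :=
            (norm_mul_le _ _).trans (mul_le_mul_of_nonneg_left (norm_mul_le _ _) (norm_nonneg _))
        _ ≤ 1 * (‖star x * x - j‖ * 1) := by gcongr
        _ = _ := by ring
    · calc _ ≤ ‖d‖ * ‖j * d‖ := norm_mul_le _ _
        _ ≤ 1 * ‖j * d‖ := by gcongr
        _ = _ := one_mul _
  have h6 := mul_self_le_mul_self Metric.infDist_nonneg h3
  linarith

theorem one_notMem_of_ne_top (hI : I ≠ ⊤) : (1 : A) ∉ I := fun h =>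
  hI (eq_top_iff.2 fun x _ => by simpa using I.mul_mem_left x 1 h)

/-- The quotient norm of a closed two-sided ideal as a seminorm. -/
noncomputable def quotientSeminorm (I : TwoSidedIdeal A) : Seminorm ℂ A :=
  Seminorm.ofSMulLE (fun x => Metric.infDist x (I : Set A)) (infDist_eq_zero_of_mem I.zero_mem)
    infDist_add_le infDist_smul_le

theorem isCStarSeminorm_quotientSeminorm (hI : IsClosed (I : Set A)) :
    IsCStarSeminorm I.quotientSeminorm where
  mul_le := infDist_mul_le
  star_mul_self := infDist_star_mul_self hI

end TwoSidedIdeal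

/-! ### The universal property -/

namespace FreeStarAlgebra

variable {ι C : Type*} [Ring C] [StarRing C] [Algebra ℂ C] [StarModule ℂ C]

/-- The unital `*`-homomorphism out of the free `*`-algebra with prescribed values on the
generators. -/
noncomputable def lift (g : ι → C) : FreeStarAlgebra ι →⋆ₐ[ℂ] C :=
  let φ : FreeStarAlgebra ι →ₐ[ℂ] C := MonoidAlgebra.lift ℂ C (FreeMonoid (ι × Bool))
    (FreeMonoid.lift fun a => if a.2 then star (g a.1) else g a.1)
  have hφ : ∀ w c, φ (mono w c) =
      c • FreeMonoid.lift (fun a : ι × Bool => if a.2 then star (g a.1) else g a.1) w :=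
    fun _ _ => MonoidAlgebra.lift_single _ _ _
  { φ with
    map_star' := fun x => by
      change φ (star x) = star (φ x)
      induction x using induct with
      | scalar c => rw [star_scalar, hφ, hφ, map_one, star_smul, star_one, Complex.star_def]
      | letter a =>
        rw [star_letter, hφ, hφ, FreeMonoid.lift_eval_of, FreeMonoid.lift_eval_of]
        rcases a with ⟨i, _ | _⟩ <;> simp
      | add x y hx hy => simp only [star_add, map_add, hx, hy]
      | mul x y hx hy => simp only [star_mul, map_mul, hx, hy] }

theorem lift_gen (g : ι → C) (i : ι) : lift g (gen i) = g i :=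
  (MonoidAlgebra.lift_single _ _ _).trans (by simp)

/-- A property of elements of a `*`-algebra generated by the images of the generators. -/
theorem induct_gen {motive : FreeStarAlgebra ι → Prop} (x : FreeStarAlgebra ι)
    (one : motive 1) (smul : ∀ (c : ℂ) x, motive x → motive (c • x)) (gen : ∀ i, motive (gen i))
    (star_gen : ∀ i, motive (star (FreeStarAlgebra.gen i)))
    (add : ∀ x y, motive x → motive y → motive (x + y))
    (mul : ∀ x y, motive x → motive y → motive (x * y)) : motive x := by
  induction x using induct with
  | scalar c =>
    have h := smul c 1 one
    rwa [one_def', smul_mono, mul_one] at h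
  | letter a =>
    rcases a with ⟨i, _ | _⟩
    · exact gen i
    · have h := star_gen i
      rwa [FreeStarAlgebra.gen, star_letter, map_one] at h
  | add x y hx hy => exact add x y hx hy
  | mul x y hx hy => exact mul x y hx hy

end FreeStarAlgebra

namespace UniversalCStar

variable {ι : Type*} {R : Set (FreeStarAlgebra ι)} {hR : AdmissibleRel R}

/-- The universal norm is the supremum of exactly such seminorms. Stating this for seminorms, not
only for homomorphisms to C*-algebras, allows quotient norms to be used directly. -/
theorem le_norm_of {p : Seminorm ℂ (FreeStarAlgebra ι)} (hp : IsCStarSeminorm p)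
    (hpR : ∀ r ∈ R, p r = 0) (x : FreeStarAlgebra ι) : p x ≤ ‖of R hR x‖ :=
  (PreUniversal.val_le_norm (hR := hR) ⟨p, hp, hpR⟩ x).trans_eq (norm_incl x).symm

theorem of_eq_zero {r : FreeStarAlgebra ι} (hr : r ∈ R) : of R hR r = 0 := by
  rw [← norm_le_zero_iff]
  refine (norm_incl (hR := hR) r).trans_le ?_
  exact PreUniversal.norm_le' fun p => (p.2.2 r hr).le

theorem denseRange_of (R : Set (FreeStarAlgebra ι)) (hR : AdmissibleRel R) :
    DenseRange (of R hR) := UniformSpace.Completion.denseRange_coe (α := PreUniversal R hR)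

variable {C : Type*} [CStarAlgebra C]

theorem _root_.IsCStarSeminorm.comp {A : Type*} [Ring A] [StarRing A] [Algebra ℂ A]
    {p : Seminorm ℂ C} (hp : IsCStarSeminorm p) (φ : A →⋆ₐ[ℂ] C) :
    IsCStarSeminorm (p.comp (φ : A →ₗ[ℂ] C)) where
  mul_le x y := by simpa using hp.mul_le (φ x) (φ y)
  star_mul_self x := by
    change p (φ (star x * x)) = p (φ x) * p (φ x)
    rw [map_mul, map_star, hp.star_mul_self]

theorem norm_le_norm_of (φ : FreeStarAlgebra ι →⋆ₐ[ℂ] C) (hφ : ∀ r ∈ R, φ r = 0)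
    (x : FreeStarAlgebra ι) : ‖φ x‖ ≤ ‖of R hR x‖ := by
  have h : IsCStarSeminorm (normSeminorm ℂ C) :=
    ⟨norm_mul_le, fun _ => CStarRing.norm_star_mul_self (E := C)⟩
  exact le_norm_of (h.comp φ) (fun r hr => by simp [hφ r hr]) x

/-- The universal property of the universal C*-algebra. -/
theorem exists_lift (hR : AdmissibleRel R) (φ : FreeStarAlgebra ι →⋆ₐ[ℂ] C)
    (hφ : ∀ r ∈ R, φ r = 0) :
    ∃ ψ : UniversalCStar R hR →⋆ₐ[ℂ] C, ∀ x, ψ (of R hR x) = φ x := by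
  let f : PreUniversal R hR →+* C := (φ : FreeStarAlgebra ι →+* C)
  have hf : Continuous f := by
    refine AddMonoidHomClass.continuous_of_bound f 1 fun x => ?_
    rw [one_mul]
    exact (norm_le_norm_of (hR := hR) φ hφ x).trans_eq (norm_incl x)
  let F : UniversalCStar R hR →+* C := UniformSpace.Completion.extensionHom f hf
  have hF : ∀ x, F (of R hR x) = φ x := UniformSpace.Completion.extensionHom_coe f hf
  have hFc : Continuous F := UniformSpace.Completion.continuous_extension
  refine ⟨{ F with
    commutes' := fun c => ?_
    map_star' := fun x => ?_ }, hF⟩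
  · have h := hF (algebraMap ℂ _ c)
    rw [AlgHomClass.commutes φ, AlgHomClass.commutes (of R hR)] at h
    exact h
  · change F (star x) = star (F x)
    induction x using (denseRange_of R hR).induction_on with
    | hp => exact isClosed_eq (hFc.comp continuous_star) (continuous_star.comp hFc)
    | ih x => rw [← map_star, hF, hF, map_star]

end UniversalCStar

/-! ### The noncommutative torus is nonzero -/

section WeightedShift

variable {G : Type*}

theorem memℓp_two_mul_comp (σ : G ≃ G) {w : G → ℂ} (hw : ∀ a, ‖w a‖ = 1) {f : G → ℂ}
    (hf : Memℓp f 2) : Memℓp (fun a => w a * f (σ a)) 2 := by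
  have h := hf.summable (by norm_num)
  refine memℓp_gen ?_
  simp only [norm_mul, hw, one_mul]
  exact (σ.summable_iff (f := fun a => ‖f a‖ ^ (2 : ENNReal).toReal)).2 h

/-- The unitary `f ↦ w · (f ∘ σ)` on `ℓ²`, for a permutation `σ` and a unimodular weight `w`. -/
noncomputable def weightedShift (σ : G ≃ G) (w : G → ℂ) (hw : ∀ a, ‖w a‖ = 1) :
    lp (fun _ : G => ℂ) 2 ≃ₗᵢ[ℂ] lp (fun _ : G => ℂ) 2 where
  toFun f := ⟨fun a => w a * f (σ a), memℓp_two_mul_comp σ hw (lp.memℓp f)⟩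
  invFun f := ⟨fun a => star (w (σ.symm a)) * f (σ.symm a),
    memℓp_two_mul_comp σ.symm (w := fun a => star (w (σ.symm a)))
      (fun a => by rw [norm_star, hw]) (lp.memℓp f)⟩
  map_add' f g := by ext a; exact mul_add _ _ _
  map_smul' c f := by ext a; exact mul_left_comm _ _ _
  left_inv f := by
    ext a
    change star (w (σ.symm a)) * (w (σ.symm a) * f (σ (σ.symm a))) = f a
    rw [← mul_assoc, Complex.star_def, Complex.conj_mul', hw, σ.apply_symm_apply]
    simp
  right_inv f := by
    ext a
    change w a * (star (w (σ.symm (σ a))) * f (σ.symm (σ a))) = f a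
    rw [σ.symm_apply_apply, ← mul_assoc, Complex.star_def, Complex.mul_conj', hw]
    simp
  norm_map' f := by
    rw [lp.norm_eq_tsum_rpow (by norm_num), lp.norm_eq_tsum_rpow (by norm_num)]
    congr 1
    change ∑' a, ‖w a * f (σ a)‖ ^ (2 : ENNReal).toReal = _
    simp only [norm_mul, hw, one_mul]
    exact σ.tsum_eq (fun a => ‖f a‖ ^ (2 : ENNReal).toReal)

theorem weightedShift_apply (σ : G ≃ G) (w : G → ℂ) (hw : ∀ a, ‖w a‖ = 1)
    (f : lp (fun _ : G => ℂ) 2) (a : G) : weightedShift σ w hw f a = w a * f (σ a) := rfl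

end WeightedShift

namespace NCTorus

variable {N : ℕ} (Θ : Fin N → Fin N → ℝ)

/-- The weight of the `i`-th generator in the regular representation on `ℓ²(ℤ^N)`. -/
noncomputable def weight (i : Fin N) (a : Fin N → ℤ) : ℂ :=
  Complex.exp ((2 * Real.pi * ∑ j, if i < j then Θ i j * a j else 0 : ℝ) * Complex.I)

theorem norm_weight (i : Fin N) (a : Fin N → ℤ) : ‖weight Θ i a‖ = 1 :=
  Complex.norm_exp_ofReal_mul_I _

/-- The phase of the `i`-th generator involves only the coordinates beyond `i`. A shift in direction
`j` is thus felt by `i` when `i < j` but not conversely, and this asymmetry produces the twist. -/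
theorem weight_sub_single (i j : Fin N) (a : Fin N → ℤ) :
    weight Θ i a = (if i < j then Complex.exp (2 * Real.pi * Complex.I * Θ i j) else 1) *
      weight Θ i (a - Pi.single j 1) := by
  have h : (∑ k, if i < k then Θ i k * a k else 0) = (if i < j then Θ i j else 0) +
      ∑ k, if i < k then Θ i k * ((a - Pi.single j 1 : Fin N → ℤ) k : ℝ) else 0 := by
    have h1 : (if i < j then Θ i j else 0) =
        ∑ k, if k = j then (if i < k then Θ i k else 0) else 0 := by simp
    rw [h1, ← Finset.sum_add_distrib]
    refine Finset.sum_congr rfl fun k _ => ?_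
    rcases eq_or_ne k j with rfl | hk
    · simp only [Pi.sub_apply, Pi.single_eq_same, if_true]
      split_ifs <;> push_cast <;> ring
    · simp [hk]
  rw [weight, weight, h]
  split_ifs
  · rw [← Complex.exp_add]
    congr 1
    push_cast
    ring
  · simp

/-- The regular representation of the generators on `ℓ²(ℤ^N)`. -/
noncomputable def regularUnitary (i : Fin N) :
    lp (fun _ : Fin N → ℤ => ℂ) 2 →L[ℂ] lp (fun _ : Fin N → ℤ => ℂ) 2 :=
  Unitary.linearIsometryEquiv.symm
    (weightedShift (Equiv.subRight (Pi.single i 1)) (weight Θ i) (norm_weight Θ i))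

theorem regularUnitary_mem (i : Fin N) : regularUnitary Θ i ∈
    unitary (lp (fun _ : Fin N → ℤ => ℂ) 2 →L[ℂ] lp (fun _ : Fin N → ℤ => ℂ) 2) :=
  SetLike.coe_mem _

theorem regularUnitary_apply (i : Fin N) (f : lp (fun _ : Fin N → ℤ => ℂ) 2) (a : Fin N → ℤ) :
    regularUnitary Θ i f a = weight Θ i a * f (a - Pi.single i 1) :=
  weightedShift_apply (Equiv.subRight (Pi.single i 1)) (weight Θ i) (norm_weight Θ i) f a

theorem regularUnitary_mul {i j : Fin N} (hij : i < j) :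
    regularUnitary Θ i * regularUnitary Θ j =
      Complex.exp (2 * Real.pi * Complex.I * Θ i j) •
        (regularUnitary Θ j * regularUnitary Θ i) := by
  ext f a
  rw [smul_apply, lp.coeFn_smul, Pi.smul_apply, mul_apply_eq_comp,
    mul_apply_eq_comp]
  simp only [regularUnitary_apply, smul_eq_mul]
  rw [weight_sub_single Θ i j a, weight_sub_single Θ j i a, if_pos hij, if_neg hij.not_gt,
    sub_right_comm]
  ring

/-- The regular representation sends `1` to the identity operator, which differs from `0` at the
delta function of the origin. -/
theorem nontrivial : Nontrivial (NCTorus N Θ) := by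
  let φ := FreeStarAlgebra.lift (regularUnitary Θ)
  have hφ : ∀ r ∈ {r | TwistRel N N Θ r}, φ r = 0 := by
    rintro r (⟨i, j, hij⟩ | i | ⟨i, hi⟩)
    · simp only [map_sub, map_mul, map_smul, φ, FreeStarAlgebra.lift_gen]
      rw [regularUnitary_mul Θ hij, sub_self]
    · simp only [map_sub, map_mul, map_star, map_one, φ, FreeStarAlgebra.lift_gen]
      rw [Unitary.star_mul_self_of_mem (regularUnitary_mem Θ i), sub_self]
    · simp only [map_sub, map_mul, map_star, map_one, φ, FreeStarAlgebra.lift_gen]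
      rw [Unitary.mul_star_self_of_mem (regularUnitary_mem Θ i), sub_self]
  obtain ⟨ψ, hψ⟩ := UniversalCStar.exists_lift (admissible_twistRel N N Θ) φ hφ
  refine ⟨⟨0, 1, fun h => ?_⟩⟩
  have h1 : (0 : lp (fun _ : Fin N → ℤ => ℂ) 2 →L[ℂ] lp (fun _ : Fin N → ℤ => ℂ) 2) = 1 := by
    rw [← map_zero ψ, h, map_one]
  have h2 := congrArg (fun T => T (lp.single 2 0 1) 0) h1
  simp at h2

end NCTorus

/-! ### Generators of twist algebras -/

namespace TwistAlgebra

variable {N m : ℕ} {Θ : Fin N → Fin N → ℝ}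

theorem gen_mul_gen {i j : Fin N} (hij : i < j) :
    gen N m Θ i * gen N m Θ j =
      Complex.exp (2 * Real.pi * Complex.I * Θ i j) • (gen N m Θ j * gen N m Θ i) := by
  have h := UniversalCStar.of_eq_zero (hR := admissible_twistRel N m Θ)
    (show _ ∈ {r | TwistRel N m Θ r} from .twist i j hij)
  rw [map_sub, map_smul, map_mul, map_mul] at h
  exact sub_eq_zero.1 h

theorem star_gen_mul_gen (i : Fin N) : star (gen N m Θ i) * gen N m Θ i = 1 := by
  have h := UniversalCStar.of_eq_zero (hR := admissible_twistRel N m Θ)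
    (show _ ∈ {r | TwistRel N m Θ r} from .isometry i)
  rw [map_sub, map_mul, map_star, map_one] at h
  exact sub_eq_zero.1 h

theorem gen_mul_star_gen {i : Fin N} (hi : i.val < m) :
    gen N m Θ i * star (gen N m Θ i) = 1 := by
  have h := UniversalCStar.of_eq_zero (hR := admissible_twistRel N m Θ)
    (show _ ∈ {r | TwistRel N m Θ r} from .unitary i hi)
  rw [map_sub, map_mul, map_star, map_one] at h
  exact sub_eq_zero.1 h

/-- A closed property stable under the `*`-algebra operations that holds for the generators holds
everywhere. -/
theorem induct_gen {motive : TwistAlgebra N m Θ → Prop} (x : TwistAlgebra N m Θ)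
    (closed : IsClosed {x | motive x}) (one : motive 1)
    (smul : ∀ (c : ℂ) x, motive x → motive (c • x)) (gen : ∀ i, motive (gen N m Θ i))
    (star_gen : ∀ i, motive (star (TwistAlgebra.gen N m Θ i)))
    (add : ∀ x y, motive x → motive y → motive (x + y))
    (mul : ∀ x y, motive x → motive y → motive (x * y)) : motive x := by
  induction x using (UniversalCStar.denseRange_of _ _).induction_on with
  | hp => exact closed
  | ih x =>
    induction x using FreeStarAlgebra.induct_gen with
    | one => rwa [map_one]
    | smul c x hx => rw [map_smul]; exact smul c _ hx
    | gen i => exact gen i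
    | star_gen i => rw [map_star]; exact star_gen i
    | add x y hx hy => rw [map_add]; exact add _ _ hx hy
    | mul x y hx hy => rw [map_mul]; exact mul _ _ hx hy

end TwistAlgebra

/-! ### The canonical map onto the noncommutative torus -/

theorem isClosed_closedIdealSpan {A : Type*} [CStarAlgebra A] (S : Set A) :
    IsClosed (closedIdealSpan S : Set A) := by
  have h : (closedIdealSpan S : Set A) =
      ⋂ I ∈ {I : TwoSidedIdeal A | IsClosed (I : Set A) ∧ S ⊆ (I : Set A)}, (I : Set A) := by
    ext x
    simp only [closedIdealSpan, SetLike.mem_coe, TwoSidedIdeal.mem_sInf, Set.mem_iInter]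
  rw [h]
  exact isClosed_biInter fun I hI => hI.1

theorem subset_closedIdealSpan {A : Type*} [CStarAlgebra A] (S : Set A) :
    S ⊆ (closedIdealSpan S : Set A) := fun _ hx =>
  (TwoSidedIdeal.mem_sInf A).2 fun _ hI => hI.2 hx

theorem closedIdealSpan_le {A : Type*} [CStarAlgebra A] {S : Set A} {I : TwoSidedIdeal A}
    (hI : IsClosed (I : Set A)) (hS : S ⊆ (I : Set A)) : closedIdealSpan S ≤ I :=
  sInf_le ⟨hI, hS⟩

theorem defectIdeal_le {m n : ℕ} {Θ : Fin (m + n) → Fin (m + n) → ℝ}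
    {I : TwoSidedIdeal (FreeTwist m n Θ)} (hI : IsClosed (I : Set (FreeTwist m n Θ)))
    (h : ∀ i, 1 - FreeTwist.gen m n Θ i * star (FreeTwist.gen m n Θ i) ∈ I) :
    defectIdeal m n Θ ≤ I := by
  refine closedIdealSpan_le hI ?_
  rintro _ ⟨i, rfl⟩
  exact h _

/-- The defects of the first `m` generators vanish, so all generators can be treated alike. -/
theorem one_sub_gen_mul_star_mem_defectIdeal {m n : ℕ} {Θ : Fin (m + n) → Fin (m + n) → ℝ}
    (i : Fin (m + n)) :
    1 - FreeTwist.gen m n Θ i * star (FreeTwist.gen m n Θ i) ∈ defectIdeal m n Θ := by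
  induction i using Fin.addCases with
  | left i =>
    have h : FreeTwist.gen m n Θ (Fin.castAdd n i) * star (FreeTwist.gen m n Θ (Fin.castAdd n i))
        = 1 := TwistAlgebra.gen_mul_star_gen (by simp)
    rw [h, sub_self]
    exact TwoSidedIdeal.zero_mem _
  | right i => exact subset_closedIdealSpan _ ⟨i, rfl⟩

/-- A bounded `*`-homomorphism of C*-algebras with dense range whose norm is the distance to the
kernel is surjective. -/
theorem StarAlgHom.surjective_of_norm_eq_infDist {A B : Type*} [CStarAlgebra A] [CStarAlgebra B]
    (f : A →⋆ₐ[ℂ] B) (hf : DenseRange f)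
    (h : ∀ x, ‖f x‖ = Metric.infDist x (TwoSidedIdeal.ker f : Set A)) : Function.Surjective f := by
  have hle : ∀ x, ‖f x‖ ≤ 1 * ‖x‖ := fun x => by
    rw [h, one_mul]; exact TwoSidedIdeal.infDist_le_norm x
  let F : NormedAddGroupHom A B := (f : A →+ B).mkNormedAddGroupHom 1 hle
  -- Subtracting a nearly optimal kernel element gives each point of the range a preimage of norm at
  -- most twice its own. The factor `2` leaves room because the distance to the kernel need not be
  -- attained. Completeness of `A` then extends such lifts to the closure of the range.
  have h1 : F.SurjectiveOnWith F.range 2 := by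
    rintro _ ⟨x, rfl⟩
    rcases eq_or_ne (f x) 0 with h0 | h0
    · exact ⟨0, by rw [map_zero]; exact h0.symm, by rw [norm_zero]; positivity⟩
    · obtain ⟨j, hj, hlt⟩ := TwoSidedIdeal.exists_norm_sub_lt (TwoSidedIdeal.ker f) x
        (norm_pos_iff.2 h0)
      refine ⟨x - j, ?_, ?_⟩
      · rw [map_sub]
        exact sub_eq_self.2 ((TwoSidedIdeal.mem_ker f).1 hj)
      · rw [← h, ← two_mul] at hlt
        exact hlt.le
  have h2 := controlled_closure_of_complete two_pos one_pos h1
  intro y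
  obtain ⟨x, hx, -⟩ := h2 y (hf y)
  exact ⟨x, hx⟩

/-- This plays the role of the universal property with target `C/I`, but needs only the quotient
seminorm, pulled back to the free algebra. -/
theorem UniversalCStar.infDist_le_norm_of {ι C : Type*} [CStarAlgebra C]
    {R : Set (FreeStarAlgebra ι)} {hR : AdmissibleRel R} {I : TwoSidedIdeal C}
    (hI : IsClosed (I : Set C)) (φ : FreeStarAlgebra ι →⋆ₐ[ℂ] C) (hφ : ∀ r ∈ R, φ r ∈ I)
    (x : FreeStarAlgebra ι) : Metric.infDist (φ x) (I : Set C) ≤ ‖of R hR x‖ :=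
  le_norm_of ((TwoSidedIdeal.isCStarSeminorm_quotientSeminorm hI).comp φ)
    (fun r hr => TwoSidedIdeal.infDist_eq_zero_of_mem (hφ r hr)) x

/-- Since `J ≤ ker μ` and `μ` is contractive, `‖μ x‖` is at most the distance to `J`; the universal
norm of the torus gives the reverse inequality. The kernel and surjectivity are then read off from
the norm formula. -/
theorem FreeTwist.exists_quotientMap (m n : ℕ) (Θ : Fin (m + n) → Fin (m + n) → ℝ) :
    ∃ μ : FreeTwist m n Θ →⋆ₐ[ℂ] NCTorus (m + n) Θ,
      (∀ i, μ (FreeTwist.gen m n Θ i) = NCTorus.gen (m + n) Θ i) ∧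
      Function.Surjective μ ∧
      TwoSidedIdeal.ker μ = defectIdeal m n Θ ∧
      (∀ x, ‖μ x‖ = Metric.infDist x (defectIdeal m n Θ : Set (FreeTwist m n Θ))) := by
  obtain ⟨μ, hμ⟩ := UniversalCStar.exists_lift (admissible_twistRel (m + n) m Θ)
    (UniversalCStar.of {r | TwistRel (m + n) (m + n) Θ r} (admissible_twistRel _ _ _)) (by
      rintro r (⟨i, j, hij⟩ | i | ⟨i, hi⟩)
      · exact UniversalCStar.of_eq_zero (.twist i j hij)
      · exact UniversalCStar.of_eq_zero (.isometry i)
      · exact UniversalCStar.of_eq_zero (.unitary i i.2))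
  have hμc : Continuous μ :=
    AddMonoidHomClass.continuous_of_bound μ 1 fun x => by
      rw [one_mul]; exact NonUnitalStarAlgHom.norm_apply_le μ x
  have hgen : ∀ i, μ (FreeTwist.gen m n Θ i) = NCTorus.gen (m + n) Θ i := fun i => hμ _
  have hkc : IsClosed (TwoSidedIdeal.ker μ : Set (FreeTwist m n Θ)) := by
    have : (TwoSidedIdeal.ker μ : Set (FreeTwist m n Θ)) = μ ⁻¹' {0} := by
      ext x; exact TwoSidedIdeal.mem_ker μ
    rw [this]
    exact isClosed_singleton.preimage hμc
  have hJk : defectIdeal m n Θ ≤ TwoSidedIdeal.ker μ := by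
    refine defectIdeal_le hkc fun i => ?_
    rw [TwoSidedIdeal.mem_ker, map_sub, map_one, map_mul, map_star, hgen]
    exact sub_eq_zero.2 (TwistAlgebra.gen_mul_star_gen i.2).symm
  have hJc : IsClosed (defectIdeal m n Θ : Set (FreeTwist m n Θ)) := isClosed_closedIdealSpan _
  set J := defectIdeal m n Θ with hJ
  have hle : ∀ x, Metric.infDist x (J : Set (FreeTwist m n Θ)) ≤ ‖μ x‖ := by
    intro x
    induction x using (UniversalCStar.denseRange_of _ _).induction_on with
    | hp => exact isClosed_le (Metric.continuous_infDist_pt _) (continuous_norm.comp hμc)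
    | ih x =>
      rw [hμ]
      refine UniversalCStar.infDist_le_norm_of hJc
        (UniversalCStar.of _ (admissible_twistRel (m + n) m Θ)) (fun r hr => ?_) x
      rcases hr with ⟨i, j, hij⟩ | i | ⟨i, hi⟩
      · rw [UniversalCStar.of_eq_zero (.twist i j hij)]
        exact J.zero_mem
      · rw [UniversalCStar.of_eq_zero (.isometry i)]
        exact J.zero_mem
      -- The first two families of relations hold exactly in the free twist; unitarity of all
      -- generators holds only modulo `J`.
      · have h := J.neg_mem (one_sub_gen_mul_star_mem_defectIdeal i)
        rw [neg_sub] at h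
        rw [map_sub, map_one, map_mul, map_star]
        exact h
  have heq : ∀ x, ‖μ x‖ = Metric.infDist x (J : Set (FreeTwist m n Θ)) := fun x => by
    refine le_antisymm (le_of_forall_pos_le_add fun ε hε => ?_) (hle x)
    obtain ⟨j, hj, hlt⟩ := J.exists_norm_sub_lt x hε
    have h1 := NonUnitalStarAlgHom.norm_apply_le μ (x - j)
    rw [map_sub, (TwoSidedIdeal.mem_ker μ).1 (hJk hj), sub_zero] at h1
    exact h1.trans hlt.le
  have hker : TwoSidedIdeal.ker μ = J := by
    refine le_antisymm (fun x hx => TwoSidedIdeal.mem_of_infDist_eq_zero hJc ?_) hJk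
    rw [← heq, (TwoSidedIdeal.mem_ker μ).1 hx, norm_zero]
  refine ⟨μ, hgen, StarAlgHom.surjective_of_norm_eq_infDist μ ?_ (by rwa [hker]), hker, heq⟩
  refine (UniversalCStar.denseRange_of _ _).mono ?_
  rintro _ ⟨x, rfl⟩
  exact ⟨_, hμ x⟩

/-! ### Simplicity from averaging over inner automorphisms -/

section Averaging

open Filter Topology Unitary

variable {A : Type*} [CStarAlgebra A] {B : Type*} {V : B → unitary A} {S : Set A}
  {χ : B → A → ℂ}

theorem norm_conjStarAlgAut (u : unitary A) (x : A) : ‖conjStarAlgAut ℂ A u x‖ = ‖x‖ := by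
  rw [conjStarAlgAut_apply, mul_assoc, CStarRing.norm_coe_unitary_mul, ← Unitary.coe_star,
    CStarRing.norm_mul_coe_unitary]

/-- The orbits of the inner automorphisms are totally bounded if these act on a total set by
scalars. -/
theorem exists_finite_coloring (hS : Dense (Submodule.span ℂ S : Set A))
    (hχ : ∀ b, ∀ s ∈ S, conjStarAlgAut ℂ A (V b) s = χ b s • s)
    (hχ1 : ∀ b, ∀ s ∈ S, ‖χ b s‖ ≤ 1) (x : A) {δ : ℝ} (hδ : 0 < δ) :
    ∃ (T : Type) (_ : Finite T) (f : B → T), ∀ b b', f b = f b' →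
      ‖conjStarAlgAut ℂ A (V b) x - conjStarAlgAut ℂ A (V b') x‖ < δ := by
  have hspan : ∀ y ∈ Submodule.span ℂ S, ∀ δ : ℝ, 0 < δ →
      ∃ (T : Type) (_ : Finite T) (f : B → T), ∀ b b', f b = f b' →
        ‖conjStarAlgAut ℂ A (V b) y - conjStarAlgAut ℂ A (V b') y‖ < δ := by
    intro y hy
    induction hy using Submodule.span_induction with
    | mem s hs =>
      intro δ hδ
      have hpos : 0 < δ / (‖s‖ + 1) := by positivity
      -- Colour `b` by a point of a finite net of the unit disc close to `χ b s`. Sums are handled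
      -- by product colourings, and general elements by approximation.
      obtain ⟨t, ht, hcover⟩ := Metric.totallyBounded_iff.1
        (isCompact_closedBall (0 : ℂ) 1).totallyBounded _ (half_pos hpos)
      have hex : ∀ b, ∃ z : t, χ b s ∈ Metric.ball (z : ℂ) (δ / (‖s‖ + 1) / 2) := fun b => by
        have h1 := hcover (mem_closedBall_zero_iff.2 (hχ1 b s hs))
        simp only [Set.mem_iUnion] at h1
        obtain ⟨z, hz, h2⟩ := h1
        exact ⟨⟨z, hz⟩, h2⟩
      choose f hf using hex
      refine ⟨t, ht, f, fun b b' hbb => ?_⟩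
      have h1 := hf b
      have h2 := hf b'
      rw [← hbb] at h2
      have h3 : dist (χ b s) (χ b' s) < δ / (‖s‖ + 1) := by
        have := dist_triangle_right (χ b s) (χ b' s) (f b)
        rw [Metric.mem_ball] at h1 h2
        linarith
      rw [hχ b s hs, hχ b' s hs, ← sub_smul, norm_smul, ← dist_eq_norm]
      rw [lt_div_iff₀ (by positivity)] at h3
      nlinarith [dist_nonneg (x := χ b s) (y := χ b' s)]
    | zero => exact fun δ hδ => ⟨Unit, inferInstance, fun _ => (), fun _ _ _ => by simpa⟩
    | add y z _ _ hy hz =>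
      intro δ hδ
      obtain ⟨T, hT, f, hf⟩ := hy _ (half_pos hδ)
      obtain ⟨T', hT', f', hf'⟩ := hz _ (half_pos hδ)
      refine ⟨T × T', inferInstance, fun b => (f b, f' b), fun b b' h => ?_⟩
      rw [Prod.mk.injEq] at h
      rw [map_add, map_add, add_sub_add_comm]
      linarith [norm_add_le (conjStarAlgAut ℂ A (V b) y - conjStarAlgAut ℂ A (V b') y)
        (conjStarAlgAut ℂ A (V b) z - conjStarAlgAut ℂ A (V b') z), hf b b' h.1, hf' b b' h.2]
    | smul c y _ hy =>
      intro δ hδ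
      have hpos : 0 < δ / (‖c‖ + 1) := by positivity
      obtain ⟨T, hT, f, hf⟩ := hy _ hpos
      refine ⟨T, hT, f, fun b b' h => ?_⟩
      have h1 := hf b b' h
      rw [map_smul, map_smul, ← smul_sub, norm_smul]
      rw [lt_div_iff₀ (by positivity)] at h1
      nlinarith [norm_nonneg (conjStarAlgAut ℂ A (V b) y - conjStarAlgAut ℂ A (V b') y)]
  obtain ⟨y, hy, hxy⟩ := Metric.mem_closure_iff.1 (hS x) (δ / 3) (by positivity)
  obtain ⟨T, hT, f, hf⟩ := hspan y hy (δ / 3) (by positivity)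
  refine ⟨T, hT, f, fun b b' h => ?_⟩
  rw [dist_eq_norm] at hxy
  have h1 : conjStarAlgAut ℂ A (V b) x - conjStarAlgAut ℂ A (V b') x =
      conjStarAlgAut ℂ A (V b) (x - y) +
        (conjStarAlgAut ℂ A (V b) y - conjStarAlgAut ℂ A (V b') y) -
        conjStarAlgAut ℂ A (V b') (x - y) := by
    rw [map_sub, map_sub]; abel
  rw [h1]
  have h2 := norm_sub_le (conjStarAlgAut ℂ A (V b) (x - y) +
    (conjStarAlgAut ℂ A (V b) y - conjStarAlgAut ℂ A (V b') y)) (conjStarAlgAut ℂ A (V b') (x - y))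
  have h3 := norm_add_le (conjStarAlgAut ℂ A (V b) (x - y))
    (conjStarAlgAut ℂ A (V b) y - conjStarAlgAut ℂ A (V b') y)
  rw [norm_conjStarAlgAut] at h2 h3
  linarith [hf b b' h]

/-- One representative index is kept for each colour that occurs. -/
theorem exists_finset_cover (hS : Dense (Submodule.span ℂ S : Set A))
    (hχ : ∀ b, ∀ s ∈ S, conjStarAlgAut ℂ A (V b) s = χ b s • s)
    (hχ1 : ∀ b, ∀ s ∈ S, ‖χ b s‖ ≤ 1) (x : A) {δ : ℝ} (hδ : 0 < δ) :
    ∃ t : Finset B, ∀ b, ∃ k ∈ t,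
      ‖conjStarAlgAut ℂ A (V b) x - conjStarAlgAut ℂ A (V k) x‖ < δ := by
  obtain ⟨T, hT, f, hf⟩ := exists_finite_coloring hS hχ hχ1 x hδ
  have hfin : (Set.range fun c : Set.range f => c.2.choose).Finite := Set.finite_range _
  refine ⟨hfin.toFinset, fun b => ⟨(⟨f b, b, rfl⟩ : Set.range f).2.choose, ?_, ?_⟩⟩
  · rw [Set.Finite.mem_toFinset]
    exact ⟨⟨f b, b, rfl⟩, rfl⟩
  · exact hf _ _ (⟨f b, b, rfl⟩ : Set.range f).2.choose_spec.symm

/-- The averages of the inner automorphisms converge to scalars if they do so on a total set. -/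
theorem exists_norm_average_sub_lt (hS : Dense (Submodule.span ℂ S : Set A))
    (hχ : ∀ b, ∀ s ∈ S, conjStarAlgAut ℂ A (V b) s = χ b s • s)
    {F : ℕ → Finset B} (hF : ∀ᶠ n in atTop, (F n).Nonempty)
    (havg : ∀ s ∈ S, (∃ c : ℂ, s = c • 1) ∨
      Tendsto (fun n => ((F n).card : ℂ)⁻¹ * ∑ b ∈ F n, χ b s) atTop (𝓝 0))
    (x : A) {ε : ℝ} (hε : 0 < ε) :
    ∃ c : ℂ, ∃ n, (F n).Nonempty ∧
      ‖((F n).card : ℂ)⁻¹ • ∑ b ∈ F n, conjStarAlgAut ℂ A (V b) x - c • 1‖ < ε := by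
  have hspan : ∀ y ∈ Submodule.span ℂ S, ∃ c : ℂ,
      Tendsto (fun n => ((F n).card : ℂ)⁻¹ • ∑ b ∈ F n, conjStarAlgAut ℂ A (V b) y) atTop
        (𝓝 (c • 1)) := by
    intro y hy
    induction hy using Submodule.span_induction with
    | mem s hs =>
      rcases havg s hs with ⟨c, rfl⟩ | h
      · refine ⟨c, tendsto_const_nhds.congr' ?_⟩
        filter_upwards [hF] with n hn
        have hn' : ((F n).card : ℂ) ≠ 0 := by exact_mod_cast hn.card_pos.ne'
        simp only [map_smul, map_one, Finset.sum_const]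
        rw [← Nat.cast_smul_eq_nsmul ℂ, smul_smul, inv_mul_cancel₀ hn', one_smul]
      · refine ⟨0, ?_⟩
        have h1 := h.smul_const s
        rw [zero_smul] at h1 ⊢
        refine h1.congr fun n => ?_
        rw [Finset.sum_congr rfl fun b _ => hχ b s hs, ← Finset.sum_smul, smul_smul]
    | zero => exact ⟨0, by simp⟩
    | add y z _ _ hy hz =>
      obtain ⟨c, hc⟩ := hy
      obtain ⟨d, hd⟩ := hz
      refine ⟨c + d, ?_⟩
      rw [add_smul]
      refine (hc.add hd).congr fun n => ?_
      rw [← smul_add, ← Finset.sum_add_distrib]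
      simp only [map_add]
    | smul a y _ hy =>
      obtain ⟨c, hc⟩ := hy
      refine ⟨a * c, ?_⟩
      rw [mul_smul]
      refine (hc.const_smul a).congr fun n => ?_
      simp only [map_smul]
      rw [← Finset.smul_sum, smul_comm]
  obtain ⟨y, hy, hxy⟩ := Metric.mem_closure_iff.1 (hS x) (ε / 2) (by positivity)
  obtain ⟨c, hc⟩ := hspan y hy
  obtain ⟨n, hn, hne⟩ := ((Metric.tendsto_nhds.1 hc (ε / 2) (by positivity)).and hF).exists
  refine ⟨c, n, hne, ?_⟩
  have hcard : (0 : ℝ) < (F n).card := by exact_mod_cast hne.card_pos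
  -- Averages of isometries are contractions, so convergence on the span passes to `x`
  -- approximately.
  have h1 : ‖((F n).card : ℂ)⁻¹ • ∑ b ∈ F n, conjStarAlgAut ℂ A (V b) (x - y)‖ ≤ ‖x - y‖ := by
    rw [norm_smul, norm_inv, Complex.norm_natCast, inv_mul_le_iff₀ hcard]
    refine (norm_sum_le _ _).trans_eq ?_
    simp only [norm_conjStarAlgAut, Finset.sum_const, nsmul_eq_mul]
  have h2 : ((F n).card : ℂ)⁻¹ • ∑ b ∈ F n, conjStarAlgAut ℂ A (V b) x - c • 1 =
      ((F n).card : ℂ)⁻¹ • ∑ b ∈ F n, conjStarAlgAut ℂ A (V b) (x - y) +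
        (((F n).card : ℂ)⁻¹ • ∑ b ∈ F n, conjStarAlgAut ℂ A (V b) y - c • 1) := by
    simp only [map_sub, Finset.sum_sub_distrib, smul_sub]
    abel
  rw [h2]
  rw [dist_eq_norm] at hn hxy
  exact (norm_add_le _ _).trans_lt (by linarith)

/-- Suppose a proper closed ideal contains a nonzero positive `x`. Its averages stay in the ideal
and come close to scalars; as `1` has positive distance to the ideal, these scalars, and hence the
averages, are small. By total boundedness of the orbit, finitely many conjugates of an average add
up to something whose norm is at least `‖x‖ / 2`, a contradiction. -/
theorem isSimpleCStar_of_average [Nontrivial A] (hS : Dense (Submodule.span ℂ S : Set A))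
    (hχ : ∀ b, ∀ s ∈ S, conjStarAlgAut ℂ A (V b) s = χ b s • s)
    (hχ1 : ∀ b, ∀ s ∈ S, ‖χ b s‖ ≤ 1)
    {F : ℕ → Finset B} (hF : ∀ᶠ n in atTop, (F n).Nonempty)
    (havg : ∀ s ∈ S, (∃ c : ℂ, s = c • 1) ∨
      Tendsto (fun n => ((F n).card : ℂ)⁻¹ * ∑ b ∈ F n, χ b s) atTop (𝓝 0)) :
    IsSimpleCStar A := by
  refine ⟨inferInstance, fun I hI => or_iff_not_imp_right.2 fun hItop => ?_⟩
  let := CStarAlgebra.spectralOrder A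
  have := CStarAlgebra.spectralOrderedRing A
  have hd : 0 < Metric.infDist (1 : A) I := Metric.infDist_nonneg.lt_of_ne' fun h =>
    TwoSidedIdeal.one_notMem_of_ne_top hItop (TwoSidedIdeal.mem_of_infDist_eq_zero hI h)
  set d := Metric.infDist (1 : A) I with hd_def
  refine eq_bot_iff.2 fun a ha => (TwoSidedIdeal.mem_bot A).2 ?_
  by_contra ha0
  set x := star a * a with hx_def
  have hxI : x ∈ I := I.mul_mem_left _ _ ha
  have hx0 : 0 ≤ x := star_mul_self_nonneg a
  have hxn : 0 < ‖x‖ := by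
    rw [hx_def, CStarRing.norm_star_mul_self]
    have := norm_pos_iff.2 ha0
    positivity
  obtain ⟨t, ht⟩ := exists_finset_cover hS hχ hχ1 x (half_pos hxn)
  -- The average will have norm at most `ε(1 + d⁻¹)`, and `t.card` conjugates of it must stay below
  -- `‖x‖ / 2`; the extra `1` makes this strict.
  set ε : ℝ := ‖x‖ / 2 / ((t.card + 1) * (1 + d⁻¹)) with hε_def
  have hε : 0 < ε := by positivity
  obtain ⟨c, n, hne, havg⟩ := exists_norm_average_sub_lt hS hχ hF havg x hε
  have hcard : (0 : ℝ) < (F n).card := by exact_mod_cast hne.card_pos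
  set Z := ∑ b ∈ F n, conjStarAlgAut ℂ A (V b) x with hZ
  have hZI : Z ∈ I := by
    refine sum_mem fun b _ => ?_
    rw [conjStarAlgAut_apply]
    exact I.mul_mem_right _ _ (I.mul_mem_left _ _ hxI)
  have hc : ‖c‖ * d ≤ ε := by
    rcases eq_or_ne c 0 with rfl | hc0
    · simpa using hε.le
    have h1 := TwoSidedIdeal.infDist_smul_le (I := I) c⁻¹ (c • 1)
    rw [smul_smul, inv_mul_cancel₀ hc0, one_smul, norm_inv] at h1
    have h2 := TwoSidedIdeal.infDist_le_norm_sub (x := c • (1 : A))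
      (TwoSidedIdeal.smul_mem_of_mem ((F n).card : ℂ)⁻¹ hZI)
    rw [norm_sub_rev] at h2
    have h3 : d ≤ ‖c‖⁻¹ * ε := h1.trans (by gcongr; exact h2.trans havg.le)
    rwa [le_inv_mul_iff₀ (norm_pos_iff.2 hc0)] at h3
  have hZn : ‖Z‖ ≤ (F n).card * (ε * (1 + d⁻¹)) := by
    have h1 := norm_add_le (((F n).card : ℂ)⁻¹ • Z - c • 1) (c • (1 : A))
    rw [sub_add_cancel, norm_smul, norm_smul, norm_one, mul_one, norm_inv,
      Complex.norm_natCast] at h1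
    have h2 : ‖c‖ ≤ ε * d⁻¹ := by rwa [← div_eq_mul_inv, le_div_iff₀ hd]
    have h3 : ((F n).card : ℝ)⁻¹ * ‖Z‖ ≤ ε * (1 + d⁻¹) := by linarith
    rwa [inv_mul_le_iff₀ hcard] at h3
  choose k hkt hk using ht
  have hnonneg : ∀ (u : unitary A) {y : A}, 0 ≤ y → 0 ≤ conjStarAlgAut ℂ A u y := fun u y hy => by
    rw [conjStarAlgAut_apply]
    exact star_right_conjugate_nonneg hy _
  -- Undoing each conjugation by its representative returns a point within `‖x‖ / 2` of `x`, so `Y`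
  -- has norm at least half that of `(F n).card • x`. Positivity bounds `Y` above by the sum over
  -- all representatives, that is, by `t.card` conjugates of `Z`.
  set Y := ∑ b ∈ F n, conjStarAlgAut ℂ A (V (k b))⁻¹ (conjStarAlgAut ℂ A (V b) x) with hY
  have hY0 : 0 ≤ Y := Finset.sum_nonneg fun b _ => hnonneg _ (hnonneg _ hx0)
  have hYle : Y ≤ ∑ j ∈ t, conjStarAlgAut ℂ A (V j)⁻¹ Z := by
    simp only [hZ, map_sum]
    rw [Finset.sum_comm]
    refine Finset.sum_le_sum fun b _ => ?_
    exact Finset.single_le_sum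
      (f := fun j => conjStarAlgAut ℂ A (V j)⁻¹ (conjStarAlgAut ℂ A (V b) x))
      (fun j _ => hnonneg _ (hnonneg _ hx0)) (hkt b)
  have hYn : ‖Y‖ ≤ t.card * ‖Z‖ := by
    refine (CStarAlgebra.norm_le_norm_of_nonneg_of_le hY0 hYle).trans ?_
    refine (norm_sum_le _ _).trans_eq ?_
    simp only [norm_conjStarAlgAut, Finset.sum_const, nsmul_eq_mul]
  have hYx : ‖Y - (F n).card • x‖ ≤ (F n).card * (‖x‖ / 2) := by
    rw [← Finset.sum_const, hY, ← Finset.sum_sub_distrib, ← nsmul_eq_mul, ← Finset.sum_const]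
    refine norm_sum_le_of_le _ fun b _ => ?_
    have h1 : conjStarAlgAut ℂ A (V (k b))⁻¹ (conjStarAlgAut ℂ A (V b) x) - x =
        conjStarAlgAut ℂ A (V (k b))⁻¹
          (conjStarAlgAut ℂ A (V b) x - conjStarAlgAut ℂ A (V (k b)) x) := by
      rw [map_sub, sub_right_inj, ← StarAlgEquiv.mul_apply, ← map_mul, inv_mul_cancel, map_one]
      rfl
    rw [h1, norm_conjStarAlgAut]
    exact (hk b).le
  have hlow : (F n).card * (‖x‖ / 2) ≤ ‖Y‖ := by
    have h1 := norm_sub_norm_le ((F n).card • x) Y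
    rw [norm_sub_rev, ← Nat.cast_smul_eq_nsmul ℂ, norm_smul, Complex.norm_natCast,
      Nat.cast_smul_eq_nsmul ℂ] at h1
    linarith
  have hfin : (F n).card * (‖x‖ / 2) < (F n).card * (‖x‖ / 2) := by
    have h2 : (t.card : ℝ) * (ε * (1 + d⁻¹)) < ‖x‖ / 2 := by
      have h3 : (t.card + 1 : ℝ) * (ε * (1 + d⁻¹)) = ‖x‖ / 2 := by
        rw [hε_def]; field_simp
      have h4 : 0 < ε * (1 + d⁻¹) := by positivity
      linarith
    calc _ ≤ ‖Y‖ := hlow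
      _ ≤ t.card * ((F n).card * (ε * (1 + d⁻¹))) := hYn.trans (by gcongr)
      _ = (F n).card * (t.card * (ε * (1 + d⁻¹))) := by ring
      _ < _ := by gcongr
  exact lt_irrefl _ hfin

end Averaging

/-! ### Projective representations of `ℤ^N` -/

section Projective

variable {A : Type*} [CStarAlgebra A]

/-- The unitaries that are scalar multiples of the identity. -/
def scalarUnitaries (A : Type*) [CStarAlgebra A] : Subgroup (unitary A) where
  carrier := {v | ∃ c : ℂ, (v : A) = c • 1}
  one_mem' := ⟨1, by simp⟩
  mul_mem' := by
    rintro v w ⟨c, hc⟩ ⟨d, hd⟩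
    exact ⟨c * d, by rw [Submonoid.coe_mul, hc, hd, smul_mul_smul_comm, one_mul]⟩
  inv_mem' := by
    rintro v ⟨c, hc⟩
    exact ⟨star c, by rw [← Unitary.star_eq_inv, Unitary.coe_star, hc, star_smul, star_one]⟩

theorem mem_scalarUnitaries {v : unitary A} :
    v ∈ scalarUnitaries A ↔ ∃ c : ℂ, (v : A) = c • 1 := Iff.rfl

instance : (scalarUnitaries A).Normal where
  conj_mem := by
    rintro v ⟨c, hc⟩ g
    refine ⟨c, ?_⟩
    rw [Submonoid.coe_mul, Submonoid.coe_mul, hc, mul_smul_comm, mul_one, smul_mul_assoc,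
      ← Unitary.star_eq_inv, Unitary.coe_star, Unitary.mul_star_self_of_mem g.2]

theorem mk_scalarUnitaries_eq_iff {v w : unitary A} :
    (v : unitary A ⧸ scalarUnitaries A) = w ↔ ∃ c : ℂ, (v : A) = c • (w : A) := by
  rw [eq_comm, QuotientGroup.eq, mem_scalarUnitaries]
  refine exists_congr fun c => ⟨fun h => ?_, fun h => ?_⟩
  · have h1 := congrArg ((w : A) * ·) h
    simp only [mul_smul_comm, mul_one] at h1
    rw [← h1, ← Submonoid.coe_mul, mul_inv_cancel_left w v]
  · rw [Submonoid.coe_mul, h, mul_smul_comm, ← Submonoid.coe_mul, inv_mul_cancel,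
      Submonoid.coe_one]

/-- Unitaries that commute up to scalars generate a projective representation of `ℤ^N`. -/
theorem exists_projective {N : ℕ} (u : Fin N → unitary A)
    (hu : ∀ i j, ∃ c : ℂ, (u i * u j : A) = c • (u j * u i : A)) :
    ∃ U : (Fin N → ℤ) → unitary A, (∀ i, ∃ c : ℂ, (U (Pi.single i 1) : A) = c • (u i : A)) ∧
      (∃ c : ℂ, (U 0 : A) = c • 1) ∧
      ∀ a b, ∃ c : ℂ, (U (a + b) : A) = c • (U a * U b : A) := by
  -- Modulo scalars the `u i` commute, so they define a homomorphism from `ℤ^N`. Any choice of lifts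
  -- serves as `U`, and the cocycle never has to be computed.
  let Q := unitary A ⧸ scalarUnitaries A
  have hcomm : Pairwise fun i j => ∀ x y : Multiplicative ℤ,
      Commute (zpowersHom Q (u i : Q) x) (zpowersHom Q (u j : Q) y) := by
    intro i j _ x y
    rw [zpowersHom_apply, zpowersHom_apply]
    refine Commute.zpow_zpow ?_ _ _
    change ((u i * u j : unitary A) : Q) = ((u j * u i : unitary A) : Q)
    exact mk_scalarUnitaries_eq_iff.2 (hu i j)
  let P : (Fin N → Multiplicative ℤ) →* Q :=
    MonoidHom.noncommPiCoprod (fun i => zpowersHom Q (u i : Q)) hcomm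
  have hsurj : ∀ q : Q, ∃ v : unitary A, (v : Q) = q := QuotientGroup.mk_surjective
  choose out hout using hsurj
  refine ⟨fun a => out (P fun i => .ofAdd (a i)), fun i => ?_, ?_, fun a b => ?_⟩
  · rw [← mk_scalarUnitaries_eq_iff, hout]
    have h : (fun j => Multiplicative.ofAdd ((Pi.single i 1 : Fin N → ℤ) j)) =
        Pi.mulSingle i (Multiplicative.ofAdd 1) := by
      ext j
      rcases eq_or_ne j i with rfl | hj
      · simp
      · simp [hj]
    rw [h, MonoidHom.noncommPiCoprod_mulSingle]
    simp
  · rw [← Submonoid.coe_one, ← mk_scalarUnitaries_eq_iff, hout]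
    exact map_one P
  · rw [← Submonoid.coe_mul, ← mk_scalarUnitaries_eq_iff, hout, QuotientGroup.mk_mul, hout, hout,
      ← map_mul]
    rfl

theorem coe_unitary_inv_mul_cancel_left (v : unitary A) (x : A) : star (v : A) * (v * x) = x := by
  rw [← mul_assoc, Unitary.coe_star_mul_self, one_mul]

/-- Commutation with a projective representation of `ℤ^N` up to a character is determined on the
standard basis. -/
theorem mul_eq_smul_mul_of_single {N : ℕ} {U : (Fin N → ℤ) → unitary A}
    (h0 : ∃ c : ℂ, (U 0 : A) = c • 1)
    (hadd : ∀ a b, ∃ c : ℂ, (U (a + b) : A) = c • (U a * U b : A)) (v : A)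
    (ψ : AddChar (Fin N → ℤ) ℂ)
    (hψ : ∀ i, v * U (Pi.single i 1) = ψ (Pi.single i 1) • (U (Pi.single i 1) * v : A))
    (a : Fin N → ℤ) : v * U a = ψ a • (U a * v : A) := by
  rcases subsingleton_or_nontrivial A with hA | hA
  · exact Subsingleton.elim _ _
  -- The exponents obeying the relation form a subgroup containing the standard basis. For
  -- negatives, `U a * U (-a)` is a scalar and commutes with `v`, so the factor `ψ a` picked up at
  -- `U a` must be cancelled at `U (-a)`.
  let H : AddSubgroup (Fin N → ℤ) :=
    { carrier := {a | v * U a = ψ a • (U a * v : A)}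
      zero_mem' := by
        obtain ⟨c, hc⟩ := h0
        change v * U 0 = ψ 0 • (U 0 * v : A)
        rw [hc, AddChar.map_zero_eq_one, one_smul, mul_smul_comm, smul_mul_assoc, mul_one, one_mul]
      add_mem' := by
        intro a b ha hb
        obtain ⟨c, hc⟩ := hadd a b
        change v * U a = ψ a • (U a * v : A) at ha
        change v * U b = ψ b • (U b * v : A) at hb
        change v * U (a + b) = ψ (a + b) • (U (a + b) * v : A)
        rw [hc, mul_smul_comm, ← mul_assoc, ha, smul_mul_assoc, mul_assoc, hb, mul_smul_comm,
          AddChar.map_add_eq_mul, smul_mul_assoc, smul_smul, smul_smul, smul_smul, mul_assoc (U a : A)]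
        congr 1
        ring
      neg_mem' := by
        intro a ha
        obtain ⟨c, hc⟩ := hadd a (-a)
        obtain ⟨d, hd⟩ := h0
        change v * U a = ψ a • (U a * v : A) at ha
        change v * U (-a) = ψ (-a) • (U (-a) * v : A)
        have hψa : ψ a * ψ (-a) = 1 := by
          rw [← AddChar.map_add_eq_mul, add_neg_cancel, AddChar.map_zero_eq_one]
        rw [add_neg_cancel, hd] at hc
        have h1 : v * (U a * U (-a) : A) = U a * (U (-a) * v) := by
          have hc0 : c ≠ 0 := by
            rintro rfl
            rw [zero_smul, ← hd] at hc
            have h2 := coe_unitary_inv_mul_cancel_left (U 0) 1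
            rw [hc, zero_mul, mul_zero] at h2
            exact zero_ne_one h2
          have h2 : (U a * U (-a) : A) = (c⁻¹ * d) • 1 := by
            rw [mul_smul, hc, smul_smul, inv_mul_cancel₀ hc0, one_smul]
          rw [← mul_assoc (U a : A), h2, mul_smul_comm, smul_mul_assoc, mul_one, one_mul]
        rw [← mul_assoc, ha, smul_mul_assoc, mul_assoc] at h1
        have h2 := congrArg (fun y => ψ (-a) • (star (U a : A) * y)) h1
        simp only [mul_smul_comm, coe_unitary_inv_mul_cancel_left, smul_smul] at h2
        rw [mul_comm, hψa, one_smul] at h2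
        exact h2 }
  have hH : ∀ i, Pi.single i 1 ∈ H := hψ
  have ha : a = ∑ i, a i • (Pi.single i 1 : Fin N → ℤ) := by
    ext j
    simp [Finset.sum_apply, Pi.single_apply]
  have : a ∈ H := by
    rw [ha]
    exact sum_mem fun i _ => H.zsmul_mem (hH i) _
  exact this

end Projective

/-! ### Simplicity of the noncommutative torus -/

section BoxAverage

open Filter Topology

variable {N : ℕ}

theorem AddChar.apply_eq_prod_single_zpow (ψ : AddChar (Fin N → ℤ) ℂ) (a : Fin N → ℤ) :
    ψ a = ∏ i, ψ (Pi.single i 1) ^ a i := by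
  have ha : a = ∑ i, a i • (Pi.single i 1 : Fin N → ℤ) := by
    ext j
    simp [Finset.sum_apply, Pi.single_apply]
  have hs : ∀ s : Finset (Fin N), ψ (∑ i ∈ s, a i • (Pi.single i 1 : Fin N → ℤ)) =
      ∏ i ∈ s, ψ (Pi.single i 1) ^ a i := fun s => by
    induction s using Finset.induction_on with
    | empty => simp
    | insert i s hi ih =>
      rw [Finset.sum_insert hi, Finset.prod_insert hi, AddChar.map_add_eq_mul, ih,
        AddChar.map_zsmul_eq_zpow]
  conv_lhs => rw [ha]
  exact hs _

theorem norm_geom_sum_le {z : ℂ} (hz : ‖z‖ = 1) (hz1 : z ≠ 1) (n : ℕ) :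
    ‖∑ t ∈ Finset.range n, z ^ t‖ ≤ 2 / ‖z - 1‖ := by
  rw [geom_sum_eq hz1, norm_div]
  gcongr
  refine (norm_sub_le _ _).trans_eq ?_
  rw [norm_pow, hz, one_pow, norm_one]
  norm_num

/-- The averages of a nontrivial unitary character of `ℤ^N` over growing boxes tend to zero. -/
theorem AddChar.tendsto_box_average {ψ : AddChar (Fin N → ℤ) ℂ} (hψ : ∀ a, ‖ψ a‖ = 1)
    {y : Fin N → ℤ} (hy : ψ y ≠ 1) :
    Tendsto (fun n : ℕ => ((Fintype.piFinset fun _ : Fin N => Finset.range n).card : ℂ)⁻¹ *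
      ∑ b ∈ Fintype.piFinset fun _ : Fin N => Finset.range n, ψ fun i => (b i : ℤ))
      atTop (𝓝 0) := by
  -- The box average factors over the coordinates. A coordinate on which `ψ` is nontrivial
  -- contributes a geometric sum of order `1/n`; all other factors have norm at most `1`.
  obtain ⟨i, hi⟩ : ∃ i, ψ (Pi.single i 1) ≠ 1 := by
    by_contra! h
    refine hy ?_
    rw [AddChar.apply_eq_prod_single_zpow]
    simp [h]
  have hi' : 0 < ‖ψ (Pi.single i 1) - 1‖ := norm_pos_iff.2 (sub_ne_zero.2 hi)
  have hlim : Tendsto (fun n : ℕ => 2 / ‖ψ (Pi.single i 1) - 1‖ * (n : ℝ)⁻¹) atTop (𝓝 0) := by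
    have := (tendsto_inv_atTop_zero.comp (tendsto_natCast_atTop_atTop (R := ℝ))).const_mul
      (2 / ‖ψ (Pi.single i 1) - 1‖)
    rwa [mul_zero] at this
  refine squeeze_zero_norm' ?_ hlim
  filter_upwards [eventually_gt_atTop 0] with n hn
  have hn' : (0 : ℝ) < n := by exact_mod_cast hn
  have h1 : ∑ b ∈ Fintype.piFinset fun _ : Fin N => Finset.range n, ψ (fun i => (b i : ℤ)) =
      ∏ j, ∑ t ∈ Finset.range n, ψ (Pi.single j 1) ^ t := by
    rw [Finset.prod_univ_sum]
    refine Finset.sum_congr rfl fun b _ => ?_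
    rw [AddChar.apply_eq_prod_single_zpow]
    simp only [zpow_natCast]
  have h2 : ((Fintype.piFinset fun _ : Fin N => Finset.range n).card : ℂ)⁻¹ *
      ∏ j, ∑ t ∈ Finset.range n, ψ (Pi.single j 1) ^ t =
      ∏ j, ((n : ℂ)⁻¹ * ∑ t ∈ Finset.range n, ψ (Pi.single j 1) ^ t) := by
    rw [Finset.prod_mul_distrib, Fintype.card_piFinset]
    simp
  rw [h1, h2, norm_prod, ← Finset.mul_prod_erase _ _ (Finset.mem_univ i), norm_mul, norm_inv,
    Complex.norm_natCast]
  have h3 : ∏ j ∈ Finset.univ.erase i,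
      ‖(n : ℂ)⁻¹ * ∑ t ∈ Finset.range n, ψ (Pi.single j 1) ^ t‖ ≤ 1 := by
    refine Finset.prod_le_one (fun _ _ => norm_nonneg _) fun j _ => ?_
    rw [norm_mul, norm_inv, Complex.norm_natCast, inv_mul_le_iff₀ hn', mul_one]
    refine (norm_sum_le _ _).trans_eq ?_
    simp [norm_pow, hψ]
  calc _ ≤ (n : ℝ)⁻¹ * ‖∑ t ∈ Finset.range n, ψ (Pi.single i 1) ^ t‖ * 1 := by gcongr
    _ ≤ (n : ℝ)⁻¹ * (2 / ‖ψ (Pi.single i 1) - 1‖) * 1 := by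
        gcongr
        exact norm_geom_sum_le (hψ _) hi n
    _ = _ := by ring

end BoxAverage

/-! ### The bicharacter of `ℤ^N` attached to a real matrix. -/

section Pairing

variable {N : ℕ}

/-- The character `b ↦ e^{2πi⟨a, M b⟩}` of `ℤ^N`. -/
noncomputable def pairing (M : Matrix (Fin N) (Fin N) ℝ) (a : Fin N → ℤ) :
    AddChar (Fin N → ℤ) ℂ where
  toFun b := Complex.exp (2 * Real.pi * Complex.I *
    (((fun i => (a i : ℝ)) ⬝ᵥ M.mulVec (fun i => (b i : ℝ)) : ℝ) : ℂ))
  map_zero_eq_one' := by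
    have h : (fun i => ((0 : Fin N → ℤ) i : ℝ)) = 0 := by ext; simp
    rw [h]
    simp
  map_add_eq_mul' b c := by
    have h : (fun i => ((b + c) i : ℝ)) = (fun i => (b i : ℝ)) + fun i => (c i : ℝ) := by
      ext; simp
    rw [h, Matrix.mulVec_add, dotProduct_add, ← Complex.exp_add]
    push_cast
    rw [mul_add]

theorem pairing_apply (M : Matrix (Fin N) (Fin N) ℝ) (a b : Fin N → ℤ) :
    pairing M a b = Complex.exp (2 * Real.pi * Complex.I *
      (((fun i => (a i : ℝ)) ⬝ᵥ M.mulVec (fun i => (b i : ℝ)) : ℝ) : ℂ)) := rfl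

theorem norm_pairing (M : Matrix (Fin N) (Fin N) ℝ) (a b : Fin N → ℤ) : ‖pairing M a b‖ = 1 := by
  rw [pairing_apply, Complex.norm_exp]
  simp

theorem pairing_single_single (M : Matrix (Fin N) (Fin N) ℝ) (i j : Fin N) :
    pairing M (Pi.single i 1) (Pi.single j 1) =
      Complex.exp (2 * Real.pi * Complex.I * M i j) := by
  have h : ∀ k : Fin N, (fun l => ((Pi.single k 1 : Fin N → ℤ) l : ℝ)) = Pi.single k 1 := by
    intro k
    ext l
    rcases eq_or_ne l k with rfl | hl
    · simp
    · simp [hl]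
  rw [pairing_apply, h, h]
  simp

theorem pairing_swap {M : Matrix (Fin N) (Fin N) ℝ} (hM : M.transpose = -M)
    (a b : Fin N → ℤ) : pairing M a b = (pairing M b a)⁻¹ := by
  rw [pairing_apply, pairing_apply, ← Complex.exp_neg, Matrix.dotProduct_mulVec,
    ← Matrix.mulVec_transpose, hM, Matrix.neg_mulVec, neg_dotProduct, dotProduct_comm]
  push_cast
  rw [mul_neg]

theorem skewMatrix_transpose (Θ : Fin N → Fin N → ℝ) :
    (skewMatrix Θ).transpose = -skewMatrix Θ := by
  ext i j
  simp only [skewMatrix, Matrix.transpose_apply, Matrix.of_apply, Matrix.neg_apply]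
  rcases lt_trichotomy i j with h | rfl | h
  · simp [h, h.not_gt]
  · simp
  · simp [h, h.not_gt]

end Pairing

/-! ### The projective representation of `ℤ^N` inside the torus. -/

namespace NCTorus

open Filter Topology Unitary

variable {N : ℕ} {Θ : Fin N → Fin N → ℝ}

/-- The generators of the noncommutative torus as unitaries. -/
noncomputable def unitaryGen (Θ : Fin N → Fin N → ℝ) (i : Fin N) : unitary (NCTorus N Θ) :=
  ⟨gen N Θ i, Unitary.mem_iff.2
    ⟨TwistAlgebra.star_gen_mul_gen i, TwistAlgebra.gen_mul_star_gen i.2⟩⟩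

theorem unitaryGen_mul (i j : Fin N) : (unitaryGen Θ i * unitaryGen Θ j : NCTorus N Θ) =
    pairing (skewMatrix Θ) (Pi.single i 1) (Pi.single j 1) •
      (unitaryGen Θ j * unitaryGen Θ i : NCTorus N Θ) := by
  have hlt : ∀ {i j : Fin N}, i < j → (unitaryGen Θ i * unitaryGen Θ j : NCTorus N Θ) =
      pairing (skewMatrix Θ) (Pi.single i 1) (Pi.single j 1) •
        (unitaryGen Θ j * unitaryGen Θ i : NCTorus N Θ) := fun {i j} h => by
    rw [pairing_single_single, skewMatrix, Matrix.of_apply, if_pos h]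
    exact TwistAlgebra.gen_mul_gen h
  rcases lt_trichotomy i j with h | rfl | h
  · exact hlt h
  · rw [pairing_single_single, skewMatrix, Matrix.of_apply, if_neg (lt_irrefl i),
      if_neg (lt_irrefl i)]
    simp
  · rw [hlt h, smul_smul, pairing_swap (skewMatrix_transpose Θ), inv_mul_cancel₀, one_smul]
    rw [pairing_apply]
    exact Complex.exp_ne_zero _

/-- Left multiplication by a generator or its adjoint translates the exponent of `U a`, up to a
nonzero scalar. So the closed span is a left ideal, and it contains `1` because `U 0` is a nonzero
scalar. -/
theorem dense_span_range {U : (Fin N → ℤ) → unitary (NCTorus N Θ)}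
    (h1 : ∀ i, ∃ c : ℂ, (U (Pi.single i 1) : NCTorus N Θ) = c • (unitaryGen Θ i : NCTorus N Θ))
    (h0 : ∃ c : ℂ, (U 0 : NCTorus N Θ) = c • 1)
    (hadd : ∀ a b, ∃ c : ℂ, (U (a + b) : NCTorus N Θ) = c • (U a * U b : NCTorus N Θ)) :
    Dense (Submodule.span ℂ (Set.range fun a => (U a : NCTorus N Θ)) : Set (NCTorus N Θ)) := by
  have hnt := NCTorus.nontrivial Θ
  have hU : ∀ a, (U a : NCTorus N Θ) ≠ 0 := fun a h => by
    have h2 := coe_unitary_inv_mul_cancel_left (U a) 1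
    rw [h, zero_mul, mul_zero] at h2
    exact zero_ne_one h2
  have hrec : ∀ i a, ∃ c : ℂ, c ≠ 0 ∧
      (U (Pi.single i 1 + a) : NCTorus N Θ) = c • (unitaryGen Θ i * U a : NCTorus N Θ) := by
    intro i a
    obtain ⟨c, hc⟩ := h1 i
    obtain ⟨d, hd⟩ := hadd (Pi.single i 1) a
    have h : (U (Pi.single i 1 + a) : NCTorus N Θ) =
        (d * c) • (unitaryGen Θ i * U a : NCTorus N Θ) := by
      rw [hd, hc, smul_mul_assoc, smul_smul]
    refine ⟨d * c, fun h' => hU (Pi.single i 1 + a) ?_, h⟩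
    rw [h, h', zero_smul]
  set T := (Submodule.span ℂ (Set.range fun a => (U a : NCTorus N Θ))).topologicalClosure with hT
  have hTU : ∀ a, (U a : NCTorus N Θ) ∈ T := fun a =>
    Submodule.le_topologicalClosure _ (Submodule.subset_span ⟨a, rfl⟩)
  have hTc : IsClosed (T : Set (NCTorus N Θ)) := Submodule.isClosed_topologicalClosure _
  have hext : ∀ x : NCTorus N Θ, (∀ a, x * U a ∈ T) → ∀ y ∈ T, x * y ∈ T := by
    intro x hx
    have h : T ≤ T.comap (LinearMap.mulLeft ℂ x) := by
      refine Submodule.topologicalClosure_minimal _ (Submodule.span_le.2 ?_) ?_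
      · rintro _ ⟨a, rfl⟩
        exact hx a
      · exact hTc.preimage (continuous_const.mul continuous_id)
    exact fun y hy => h hy
  have hmul : ∀ x : NCTorus N Θ, ∀ y ∈ T, x * y ∈ T := by
    intro x
    induction x using TwistAlgebra.induct_gen with
    | closed =>
      simp only [Set.ofPred_forall]
      exact isClosed_iInter fun y => isClosed_iInter fun _ =>
        hTc.preimage (continuous_id.mul continuous_const)
    | one => intro y hy; rwa [one_mul]
    | smul c x hx => intro y hy; rw [smul_mul_assoc]; exact T.smul_mem c (hx y hy)
    | add x z hx hz => intro y hy; rw [add_mul]; exact T.add_mem (hx y hy) (hz y hy)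
    | mul x z hx hz => intro y hy; rw [mul_assoc]; exact hx _ (hz y hy)
    | gen i =>
      refine hext _ fun a => ?_
      obtain ⟨c, hc0, hc⟩ := hrec i a
      have h : (unitaryGen Θ i * U a : NCTorus N Θ) = c⁻¹ • (U (Pi.single i 1 + a) : NCTorus N Θ) := by
        rw [hc, smul_smul, inv_mul_cancel₀ hc0, one_smul]
      change (unitaryGen Θ i * U a : NCTorus N Θ) ∈ T
      rw [h]
      exact T.smul_mem _ (hTU _)
    | star_gen i =>
      refine hext _ fun a => ?_
      -- The shifted exponent writes `U a` as a multiple of `uᵢ * U (a - eᵢ)`, from which `star uᵢ`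
      -- cancels `uᵢ`.
      obtain ⟨c, hc0, hc⟩ := hrec i (a - Pi.single i 1)
      rw [add_sub_cancel] at hc
      change star (unitaryGen Θ i : NCTorus N Θ) * U a ∈ T
      rw [hc, mul_smul_comm, coe_unitary_inv_mul_cancel_left]
      exact T.smul_mem _ (hTU _)
  obtain ⟨c, hc⟩ := h0
  have hc0 : c ≠ 0 := fun h => hU 0 (by rw [hc, h, zero_smul])
  have h1T : (1 : NCTorus N Θ) ∈ T := by
    have h := T.smul_mem c⁻¹ (hTU 0)
    rwa [hc, smul_smul, inv_mul_cancel₀ hc0, one_smul] at h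
  intro x
  have hx := hmul x 1 h1T
  rwa [mul_one] at hx

/-- The commutation factor of `U a` and `U b` is the bicharacter `pairing`, checked on the basis in
one variable at a time. Nondegeneracy makes its characters nontrivial for `a ≠ 0`, so box averages
kill all `U a` except the scalar `U 0`. -/
theorem isSimpleCStar (hΘ : IsNondegenerate (skewMatrix Θ)) : IsSimpleCStar (NCTorus N Θ) := by
  have hnt := NCTorus.nontrivial Θ
  obtain ⟨U, h1, h0, hadd⟩ := exists_projective (unitaryGen Θ) fun i j => ⟨_, unitaryGen_mul i j⟩
  have hcomm1 : ∀ i a, (U (Pi.single i 1) * U a : NCTorus N Θ) =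
      pairing (skewMatrix Θ) (Pi.single i 1) a • (U a * U (Pi.single i 1) : NCTorus N Θ) := by
    intro i
    refine mul_eq_smul_mul_of_single h0 hadd _ _ fun j => ?_
    obtain ⟨c, hc⟩ := h1 i
    obtain ⟨d, hd⟩ := h1 j
    rw [hc, hd, smul_mul_smul_comm, smul_mul_smul_comm, unitaryGen_mul, smul_smul, smul_smul]
    congr 1
    ring
  have hcomm : ∀ a b, (U a * U b : NCTorus N Θ) =
      pairing (skewMatrix Θ) a b • (U b * U a : NCTorus N Θ) := by
    intro a
    refine mul_eq_smul_mul_of_single h0 hadd _ _ fun j => ?_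
    rw [hcomm1, smul_smul, pairing_swap (skewMatrix_transpose Θ), inv_mul_cancel₀, one_smul]
    rw [pairing_apply]
    exact Complex.exp_ne_zero _
  set f : (Fin N → ℤ) → NCTorus N Θ := fun a => (U a : NCTorus N Θ) with hf
  have hinv : ∀ s ∈ Set.range f, (U (Function.invFun f s) : NCTorus N Θ) = s := fun s hs =>
    Function.invFun_eq hs
  -- The scalars are indexed by elements of the algebra, so `Function.invFun` chooses an exponent
  -- for each of them; injectivity of `f` is not required.
  refine isSimpleCStar_of_average (B := Fin N → ℕ) (V := fun b => U fun i => (b i : ℤ))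
    (S := Set.range f)
    (χ := fun b s => pairing (skewMatrix Θ) (fun i => (b i : ℤ)) (Function.invFun f s))
    (F := fun n => Fintype.piFinset fun _ => Finset.range n)
    (dense_span_range h1 h0 hadd) ?_ ?_ ?_ ?_
  · intro b s hs
    conv_lhs => rw [← hinv s hs]
    rw [conjStarAlgAut_apply, hcomm, smul_mul_assoc, mul_assoc,
      Unitary.mul_star_self_of_mem (SetLike.coe_mem _), mul_one, hinv s hs]
  · exact fun b s _ => (norm_pairing _ _ _).le
  · filter_upwards [eventually_gt_atTop 0] with n hn
    exact Fintype.piFinset_nonempty.2 fun _ => Finset.nonempty_range_iff.2 hn.ne'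
  · intro s hs
    rcases eq_or_ne (Function.invFun f s) 0 with h | h
    · left
      rw [← hinv s hs, h]
      exact h0
    · right
      obtain ⟨y, hy⟩ : ∃ y, pairing (skewMatrix Θ) (Function.invFun f s) y ≠ 1 := by
        by_contra! h'
        exact h (hΘ _ h')
      -- The average runs over the first variable of the pairing; skew-symmetry moves it to the
      -- second at the cost of an inverse.
      have h2 := AddChar.tendsto_box_average (ψ := (pairing (skewMatrix Θ) (Function.invFun f s))⁻¹)
        (fun a => by rw [AddChar.inv_apply', norm_inv, norm_pairing, inv_one]) (y := y)
        (by rwa [AddChar.inv_apply', ne_eq, inv_eq_one])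
      refine h2.congr fun n => ?_
      simp only [AddChar.inv_apply', ← pairing_swap (skewMatrix_transpose Θ)]

end NCTorus

/-! ### Closed ideals of the free twist -/

namespace TwistAlgebra

variable {N m : ℕ} {Θ : Fin N → Fin N → ℝ}

theorem norm_gen_le (i : Fin N) : ‖gen N m Θ i‖ ≤ 1 := by
  have h := CStarRing.norm_star_mul_self (x := gen N m Θ i)
  rw [star_gen_mul_gen] at h
  rcases subsingleton_or_nontrivial (TwistAlgebra N m Θ) with hs | hs
  · rw [Subsingleton.elim (gen N m Θ i) 0, norm_zero]
    exact zero_le_one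
  · rw [norm_one] at h
    nlinarith [norm_nonneg (gen N m Θ i)]

theorem exists_gen_mul_gen (i j : Fin N) :
    ∃ c : ℂ, ‖c‖ = 1 ∧ gen N m Θ i * gen N m Θ j = c • (gen N m Θ j * gen N m Θ i) := by
  have hnorm : ∀ t : ℝ, ‖Complex.exp (2 * Real.pi * Complex.I * t)‖ = 1 := fun t => by
    rw [Complex.norm_exp]
    simp
  rcases lt_trichotomy i j with h | rfl | h
  · exact ⟨_, hnorm _, gen_mul_gen h⟩
  · exact ⟨1, norm_one, (one_smul _ _).symm⟩
  · refine ⟨(Complex.exp (2 * Real.pi * Complex.I * Θ j i))⁻¹, by rw [norm_inv, hnorm, inv_one], ?_⟩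
    rw [gen_mul_gen h, smul_smul, inv_mul_cancel₀ (Complex.exp_ne_zero _), one_smul]

/-- The monomials in the generators, without their adjoints. -/
noncomputable def monomials (N m : ℕ) (Θ : Fin N → Fin N → ℝ) : Submonoid (TwistAlgebra N m Θ) :=
  Submonoid.closure (Set.range (gen N m Θ))

theorem gen_mem_monomials (i : Fin N) : gen N m Θ i ∈ monomials N m Θ :=
  Submonoid.subset_closure ⟨i, rfl⟩

theorem norm_le_one_of_mem_monomials {w : TwistAlgebra N m Θ} (hw : w ∈ monomials N m Θ) :
    ‖w‖ ≤ 1 := by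
  induction hw using Submonoid.closure_induction with
  | mem x hx => obtain ⟨i, rfl⟩ := hx; exact norm_gen_le i
  | one =>
    rcases subsingleton_or_nontrivial (TwistAlgebra N m Θ) with hs | hs
    · rw [Subsingleton.elim 1 0, norm_zero]
      exact zero_le_one
    · exact norm_one.le
  | mul x y _ _ hx hy => exact (norm_mul_le x y).trans (mul_le_one₀ hx (norm_nonneg _) hy)

theorem star_mul_self_of_mem_monomials {w : TwistAlgebra N m Θ} (hw : w ∈ monomials N m Θ) :
    star w * w = 1 := by
  induction hw using Submonoid.closure_induction with
  | mem x hx => obtain ⟨i, rfl⟩ := hx; exact star_gen_mul_gen i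
  | one => simp
  | mul x y _ _ hx hy =>
    rw [star_mul, mul_assoc, ← mul_assoc (star x), hx, one_mul, hy]

theorem exists_mul_comm_of_mem_monomials {v w : TwistAlgebra N m Θ} (hv : v ∈ monomials N m Θ)
    (hw : w ∈ monomials N m Θ) : ∃ c : ℂ, ‖c‖ = 1 ∧ v * w = c • (w * v) := by
  induction hv, hw using Submonoid.closure_induction₂ with
  | mem x y hx hy =>
    obtain ⟨i, rfl⟩ := hx
    obtain ⟨j, rfl⟩ := hy
    exact exists_gen_mul_gen i j
  | one_left x _ => exact ⟨1, norm_one, by simp⟩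
  | one_right x _ => exact ⟨1, norm_one, by simp⟩
  | mul_left x y z _ _ _ hx hy =>
    obtain ⟨c, hc1, hc⟩ := hx
    obtain ⟨d, hd1, hd⟩ := hy
    exact ⟨d * c, by rw [norm_mul, hc1, hd1, one_mul], by
      rw [mul_assoc, hd, mul_smul_comm, ← mul_assoc, hc, smul_mul_assoc, smul_smul, mul_assoc]⟩
  | mul_right x y z _ _ _ hx hy =>
    obtain ⟨c, hc1, hc⟩ := hx
    obtain ⟨d, hd1, hd⟩ := hy
    exact ⟨c * d, by rw [norm_mul, hc1, hd1, one_mul], by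
      rw [← mul_assoc, hc, smul_mul_assoc, mul_assoc, hd, mul_smul_comm, smul_smul, mul_assoc]⟩

/-- The elements whose products with suitable monomials from the right come arbitrarily close
to a given ideal. -/
def IsAsymptotic (I : TwoSidedIdeal (TwistAlgebra N m Θ)) (b : TwistAlgebra N m Θ) : Prop :=
  ∀ ε > 0, ∃ w ∈ monomials N m Θ, Metric.infDist (b * w) (I : Set (TwistAlgebra N m Θ)) < ε

variable {I : TwoSidedIdeal (TwistAlgebra N m Θ)}

theorem infDist_mul_mul_le (b : TwistAlgebra N m Θ) {w : TwistAlgebra N m Θ} (v)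
    (hw : w ∈ monomials N m Θ) :
    Metric.infDist (b * (v * w)) (I : Set (TwistAlgebra N m Θ)) ≤
      Metric.infDist (b * v) (I : Set (TwistAlgebra N m Θ)) := by
  rw [← mul_assoc]
  exact (TwoSidedIdeal.infDist_mul_le_right _ _).trans
    (mul_le_of_le_one_right Metric.infDist_nonneg (norm_le_one_of_mem_monomials hw))

/-- A factor inserted before `w` can be moved behind it at the cost of a phase, and there it is a
contraction. -/
theorem infDist_mul_mul_le' (b : TwistAlgebra N m Θ) {v w : TwistAlgebra N m Θ}
    (hv : v ∈ monomials N m Θ) (hw : w ∈ monomials N m Θ) :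
    Metric.infDist (b * (v * w)) (I : Set (TwistAlgebra N m Θ)) ≤
      Metric.infDist (b * w) (I : Set (TwistAlgebra N m Θ)) := by
  obtain ⟨c, hc1, hc⟩ := exists_mul_comm_of_mem_monomials hv hw
  rw [hc, mul_smul_comm]
  refine (TwoSidedIdeal.infDist_smul_le _ _).trans ?_
  rw [hc1, one_mul]
  exact infDist_mul_mul_le b w hv

/-- The product of the two witnesses serves both summands, since witnesses may be lengthened on
either side. -/
theorem IsAsymptotic.add {b b' : TwistAlgebra N m Θ} (hb : IsAsymptotic I b)
    (hb' : IsAsymptotic I b') : IsAsymptotic I (b + b') := by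
  intro ε hε
  obtain ⟨v, hv, hlt⟩ := hb _ (half_pos hε)
  obtain ⟨w, hw, hlt'⟩ := hb' _ (half_pos hε)
  refine ⟨v * w, mul_mem hv hw, ?_⟩
  have h1 := TwoSidedIdeal.infDist_add_le (I := I) (b * (v * w)) (b' * (v * w))
  rw [← add_mul] at h1
  linarith [infDist_mul_mul_le (I := I) b v hw, infDist_mul_mul_le' (I := I) b' hv hw]

theorem IsAsymptotic.mul_left (y : TwistAlgebra N m Θ) {b : TwistAlgebra N m Θ}
    (hb : IsAsymptotic I b) : IsAsymptotic I (y * b) := by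
  intro ε hε
  obtain ⟨w, hw, hlt⟩ := hb (ε / (‖y‖ + 1)) (by positivity)
  refine ⟨w, hw, ?_⟩
  have h1 := TwoSidedIdeal.infDist_mul_le_left (I := I) y (b * w)
  rw [← mul_assoc] at h1
  rw [lt_div_iff₀ (by positivity)] at hlt
  nlinarith [Metric.infDist_nonneg (x := b * w) (s := (I : Set (TwistAlgebra N m Θ)))]

theorem isClosed_isAsymptotic : IsClosed {b | IsAsymptotic I b} := by
  refine isClosed_of_closure_subset fun b hb ε hε => ?_
  obtain ⟨b', hb', hd⟩ := Metric.mem_closure_iff.1 hb _ (half_pos hε)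
  obtain ⟨w, hw, hlt⟩ := hb' _ (half_pos hε)
  refine ⟨w, hw, ?_⟩
  have h1 := TwoSidedIdeal.infDist_add_le (I := I) ((b - b') * w) (b' * w)
  rw [← add_mul, sub_add_cancel] at h1
  have h2 := (TwoSidedIdeal.infDist_le_norm (I := I) ((b - b') * w)).trans (norm_mul_le _ _)
  rw [dist_eq_norm] at hd
  have h3 := mul_le_of_le_one_right (norm_nonneg (b - b')) (norm_le_one_of_mem_monomials hw)
  linarith

theorem IsAsymptotic.smul (c : ℂ) {b : TwistAlgebra N m Θ} (hb : IsAsymptotic I b) :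
    IsAsymptotic I (c • b) := by
  rw [← one_mul b, ← smul_mul_assoc]
  exact hb.mul_left _

/-- The right multipliers form a closed subalgebra, so generators and their adjoints suffice. For
`sᵢ` the same `w` works, because `sᵢ` moves past it; for `sᵢ*` the witness `sᵢ * w` works, because
`sᵢ* sᵢ = 1`. -/
theorem IsAsymptotic.mul_right {b : TwistAlgebra N m Θ} (hb : IsAsymptotic I b)
    (y : TwistAlgebra N m Θ) : IsAsymptotic I (b * y) := by
  have hc : IsClosed {y : TwistAlgebra N m Θ | ∀ b, IsAsymptotic I b → IsAsymptotic I (b * y)} := by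
    simp only [Set.ofPred_forall]
    exact isClosed_iInter fun b => isClosed_iInter fun _ =>
      isClosed_isAsymptotic.preimage (continuous_const.mul continuous_id)
  revert b
  change ∀ b, IsAsymptotic I b → IsAsymptotic I (b * y)
  induction y using induct_gen with
  | closed => exact hc
  | one => intro b hb; rwa [mul_one]
  | smul c y hy => intro b hb; rw [mul_smul_comm]; exact (hy b hb).smul c
  | add y z hy hz => intro b hb; rw [mul_add]; exact (hy b hb).add (hz b hb)
  | mul y z hy hz => intro b hb; rw [← mul_assoc]; exact hz _ (hy b hb)
  | gen i =>
    intro b hb ε hε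
    obtain ⟨w, hw, hlt⟩ := hb ε hε
    refine ⟨w, hw, lt_of_le_of_lt ?_ hlt⟩
    rw [mul_assoc]
    exact infDist_mul_mul_le' b (gen_mem_monomials i) hw
  | star_gen i =>
    intro b hb ε hε
    obtain ⟨w, hw, hlt⟩ := hb ε hε
    refine ⟨gen N m Θ i * w, mul_mem (gen_mem_monomials i) hw, ?_⟩
    rwa [mul_assoc, ← mul_assoc (star _), star_gen_mul_gen, one_mul]

/-- The asymptotic elements form a two-sided ideal. -/
noncomputable def asymptoticIdeal (I : TwoSidedIdeal (TwistAlgebra N m Θ)) :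
    TwoSidedIdeal (TwistAlgebra N m Θ) :=
  .mk' {b | IsAsymptotic I b}
    (fun ε hε => ⟨1, one_mem _, by
      rwa [zero_mul, TwoSidedIdeal.infDist_eq_zero_of_mem I.zero_mem]⟩)
    (fun hx hy => IsAsymptotic.add hx hy)
    (fun {x} hx => by
      rw [← neg_one_mul x]
      exact IsAsymptotic.mul_left _ hx)
    (fun {_ _} hy => IsAsymptotic.mul_left _ hy) (fun {_ _} hx => IsAsymptotic.mul_right hx _)

theorem mem_asymptoticIdeal {b : TwistAlgebra N m Θ} :
    b ∈ asymptoticIdeal I ↔ IsAsymptotic I b :=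
  TwoSidedIdeal.mem_mk' _ _ _ _ _ _ _

theorem isClosed_asymptoticIdeal :
    IsClosed (asymptoticIdeal I : Set (TwistAlgebra N m Θ)) := by
  have h : (asymptoticIdeal I : Set (TwistAlgebra N m Θ)) = {b | IsAsymptotic I b} :=
    Set.ext fun _ => mem_asymptoticIdeal
  rw [h]
  exact isClosed_isAsymptotic

theorem le_asymptoticIdeal : I ≤ asymptoticIdeal I := fun b hb =>
  mem_asymptoticIdeal.2 fun ε hε => ⟨1, one_mem _, by
    rwa [mul_one, TwoSidedIdeal.infDist_eq_zero_of_mem hb]⟩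

/-- The witness `sᵢ` annihilates the defect exactly: `(1 - sᵢsᵢ*)sᵢ = 0`. -/
theorem one_sub_gen_mul_star_mem_asymptoticIdeal (i : Fin N) :
    1 - gen N m Θ i * star (gen N m Θ i) ∈ asymptoticIdeal I :=
  mem_asymptoticIdeal.2 fun ε hε => ⟨gen N m Θ i, gen_mem_monomials i, by
    rwa [sub_mul, mul_assoc, star_gen_mul_gen, one_mul, mul_one, sub_self,
      TwoSidedIdeal.infDist_eq_zero_of_mem I.zero_mem]⟩

/-- Monomials are isometries: from `1 = star w * w`, no `w` is closer to `I` than `1` is, and that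
distance is positive. -/
theorem asymptoticIdeal_ne_top (hI : IsClosed (I : Set (TwistAlgebra N m Θ))) (hI' : I ≠ ⊤) :
    asymptoticIdeal I ≠ ⊤ := by
  intro h
  have h1 : (1 : TwistAlgebra N m Θ) ∈ asymptoticIdeal I := h ▸ TwoSidedIdeal.mem_top _
  have hpos : 0 < Metric.infDist (1 : TwistAlgebra N m Θ) I :=
    Metric.infDist_nonneg.lt_of_ne' fun h0 =>
      TwoSidedIdeal.one_notMem_of_ne_top hI' (TwoSidedIdeal.mem_of_infDist_eq_zero hI h0)
  obtain ⟨w, hw, hlt⟩ := mem_asymptoticIdeal.1 h1 _ hpos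
  have h2 := TwoSidedIdeal.infDist_mul_le_left (I := I) (star w) w
  rw [star_mul_self_of_mem_monomials hw, norm_star] at h2
  rw [one_mul] at hlt
  have h3 := mul_le_of_le_one_left (Metric.infDist_nonneg (x := w)
    (s := (I : Set (TwistAlgebra N m Θ)))) (norm_le_one_of_mem_monomials hw)
  linarith

end TwistAlgebra

/-- The kernel of a surjective `*`-homomorphism onto a simple C*-algebra is maximal. -/
theorem eq_ker_of_isSimpleCStar {A B : Type*} [CStarAlgebra A] [CStarAlgebra B]
    (hB : IsSimpleCStar B) {f : A →⋆ₐ[ℂ] B} (hf : Function.Surjective f)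
    (hnorm : ∀ x, ‖f x‖ = Metric.infDist x (TwoSidedIdeal.ker f : Set A))
    {K : TwoSidedIdeal A} (hK : IsClosed (K : Set A)) (hK' : K ≠ ⊤)
    (hle : TwoSidedIdeal.ker f ≤ K) : K = TwoSidedIdeal.ker f := by
  have hsub : ∀ {x y : A}, x ∈ K → f y = f x → y ∈ K := fun {x y} hx h => by
    have h1 : y - x ∈ TwoSidedIdeal.ker f := by
      rw [TwoSidedIdeal.mem_ker, map_sub, h, sub_self]
    simpa using K.add_mem (hle h1) hx
  let L : TwoSidedIdeal B := .mk' (f '' K) ⟨0, K.zero_mem, map_zero f⟩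
    (by rintro _ _ ⟨x, hx, rfl⟩ ⟨y, hy, rfl⟩; exact ⟨x + y, K.add_mem hx hy, map_add f x y⟩)
    (by rintro _ ⟨x, hx, rfl⟩; exact ⟨-x, K.neg_mem hx, map_neg f x⟩)
    (by
      rintro y _ ⟨x, hx, rfl⟩
      obtain ⟨y, rfl⟩ := hf y
      exact ⟨y * x, K.mul_mem_left y x hx, map_mul f y x⟩)
    (by
      rintro _ y ⟨x, hx, rfl⟩
      obtain ⟨y, rfl⟩ := hf y
      exact ⟨x * y, K.mul_mem_right x y hx, map_mul f x y⟩)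
  have hL : ∀ y, y ∈ L ↔ y ∈ f '' K := fun y => TwoSidedIdeal.mem_mk' _ _ _ _ _ _ _
  -- The norm of `f x - f z` is the distance from `x - z` to the kernel. As `K` contains the kernel,
  -- `z` can be corrected inside `K` to lie close to `x`.
  have hLc : IsClosed (L : Set B) := by
    refine isClosed_of_closure_subset fun y hy => (hL y).2 ?_
    obtain ⟨x, rfl⟩ := hf y
    refine ⟨x, ?_, rfl⟩
    refine hK.closure_subset (Metric.mem_closure_iff.2 fun ε hε => ?_)
    obtain ⟨_, hz, hlt⟩ := Metric.mem_closure_iff.1 hy ε hε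
    obtain ⟨z, hzK, rfl⟩ := (hL _).1 hz
    rw [dist_eq_norm, ← map_sub, hnorm] at hlt
    obtain ⟨j, hj, h1⟩ := (Metric.infDist_lt_iff (TwoSidedIdeal.coe_nonempty _)).1 hlt
    refine ⟨z + j, K.add_mem hzK (hle hj), ?_⟩
    rw [dist_eq_norm] at h1 ⊢
    rwa [← sub_sub]
  rcases hB.2 L hLc with h | h
  · refine le_antisymm (fun x hx => ?_) hle
    have h1 : f x ∈ L := (hL _).2 ⟨x, hx, rfl⟩
    rw [h, TwoSidedIdeal.mem_bot] at h1
    exact (TwoSidedIdeal.mem_ker f).2 h1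
  · have h1 : (1 : B) ∈ L := h ▸ TwoSidedIdeal.mem_top _
    obtain ⟨x, hx, h2⟩ := (hL _).1 h1
    exact absurd (hsub hx (by rw [map_one, h2])) (TwoSidedIdeal.one_notMem_of_ne_top hK')

/-- The asymptotic ideal of `I` is closed, proper and contains `J = ker μ`. Simplicity of the torus
forces it to equal `J`, and it contains `I`. -/
theorem FreeTwist.le_defectIdeal {m n : ℕ} {Θ : Fin (m + n) → Fin (m + n) → ℝ}
    (hΘ : IsNondegenerate (skewMatrix Θ)) {I : TwoSidedIdeal (FreeTwist m n Θ)}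
    (hI : IsClosed (I : Set (FreeTwist m n Θ))) (hI' : I ≠ ⊤) : I ≤ defectIdeal m n Θ := by
  obtain ⟨μ, -, hsurj, hker, hnorm⟩ := FreeTwist.exists_quotientMap m n Θ
  rw [← hker] at hnorm ⊢
  have hle : TwoSidedIdeal.ker μ ≤ TwistAlgebra.asymptoticIdeal I := by
    rw [hker]
    exact defectIdeal_le TwistAlgebra.isClosed_asymptoticIdeal
      TwistAlgebra.one_sub_gen_mul_star_mem_asymptoticIdeal
  rw [← eq_ker_of_isSimpleCStar (NCTorus.isSimpleCStar hΘ) hsurj hnorm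
    TwistAlgebra.isClosed_asymptoticIdeal (TwistAlgebra.asymptoticIdeal_ne_top hI hI') hle]
  exact TwistAlgebra.le_asymptoticIdeal

theorem FreeTwist.defectIdeal_ne_top (m n : ℕ) (Θ : Fin (m + n) → Fin (m + n) → ℝ) :
    defectIdeal m n Θ ≠ ⊤ := by
  obtain ⟨μ, -, -, hker, -⟩ := FreeTwist.exists_quotientMap m n Θ
  have hnt := NCTorus.nontrivial Θ
  intro h
  have h1 : (1 : FreeTwist m n Θ) ∈ TwoSidedIdeal.ker μ := by
    rw [hker, h]
    exact TwoSidedIdeal.mem_top _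
  rw [TwoSidedIdeal.mem_ker, map_one] at h1
  exact one_ne_zero h1

theorem mainTheorem12 (m n : ℕ) (hmn : 1 < m + n) (Θ : Fin (m + n) → Fin (m + n) → ℝ)
    (hΘ : IsNondegenerate (skewMatrix Θ)) :
    (∀ I : TwoSidedIdeal (FreeTwist m n Θ), IsMaximalClosedIdeal I ↔ I = defectIdeal m n Θ) ∧
    (∃ μ : FreeTwist m n Θ →⋆ₐ[ℂ] NCTorus (m + n) Θ,
      (∀ i, μ (FreeTwist.gen m n Θ i) = NCTorus.gen (m + n) Θ i) ∧
      Function.Surjective μ ∧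
      TwoSidedIdeal.ker μ = defectIdeal m n Θ ∧
      (∀ x, ‖μ x‖ = Metric.infDist x (defectIdeal m n Θ : Set (FreeTwist m n Θ)))) ∧
    IsSimpleCStar (NCTorus (m + n) Θ) := by
  have hJ : IsClosed (defectIdeal m n Θ : Set (FreeTwist m n Θ)) ∧ defectIdeal m n Θ ≠ ⊤ :=
    ⟨isClosed_closedIdealSpan _, FreeTwist.defectIdeal_ne_top m n Θ⟩
  refine ⟨fun I => ⟨fun hI => ?_, ?_⟩, FreeTwist.exists_quotientMap m n Θ,
    NCTorus.isSimpleCStar hΘ⟩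
  · exact hI.eq_of_le hJ (FreeTwist.le_defectIdeal hΘ hI.prop.1 hI.prop.2)
  · rintro rfl
    exact ⟨hJ, fun K hK _ => FreeTwist.le_defectIdeal hΘ hK.1 hK.2⟩
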